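/- **Setting.** Let $\mathcal V=\{1,\dots,N\}$ be the nodes of a connected undirected graph, $\mathcal N_i$ the set consisting of $i$ and its neighbours, $D=\max_i|\mathcal N_i|$. Node $i$ has a state $x_i\in\mathbb R^{m_i}$, $\overline m=\max_i m_i$, $x=(x_1,\dots,x_N)$, $P=\sum_i m_i$, and $x_{\mathcal N_i}$ is the concatenation of the $x_j$, $j\in\mathcal N_i$. For a vector $y$ indexed like $x_{\mathcal N_j}$ and $i\in\mathcal N_j$ let $\mathcal B_{ij}\,y$ be its block belonging to node $i$. Consider the minimization of $G(x)=F(x)+R(x)$, $F(x)=\frac1N\sum_{i=1}^N f_i(x_{\mathcal N_i})$, where * each $f_i$ is convex and differentiable, $\nabla f_i$ is affine ($\nabla f_i(z)=H_iz+h_i$) and Lipschitz with constant $L_i$; $\overline L=\max_i L_i$; * $R:\mathbb R^P\to(-\infty,+\infty]$ is proper, lower semicontinuous and convex, with closed effective domain; * for $\operatorname{prox}_R(v)=\arg\min_y\frac12\|y-v\|^2+\eta R(y)$, the $i$-th block of $\operatorname{prox}_R(v)$ is $\operatorname{prox}_{R_i}(v_i)$ for every $v$ and $i$, where $R_i$ is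 a function of $x_i$ only; * $G$ is strongly convex with parameter $\mu>0$: $G(x)\ge G(y)+\xi^{\mathsf T}(x-y)+\frac\mu2\|x-y\|^2$ for all $x,y\in\operatorname{dom}R$ and $\xi\in\partial G(y)$. Let $x^\star$ be the minimizer of $G$. **Quantizer.** With $n\ge1$ bits, a midpoint $\overline z$ and an interval size $U>0$, put $\Delta=U/(2^n-1)$, $q(z)=\overline z+\operatorname{sgn}(z-\overline z)\,\Delta\left\lfloor\frac{|z-\overline z|}{\Delta}+\frac12\right\rfloor$ and $Q(z)=q(z+\nu)-\nu$, where the dither $\nu$ is uniform on $(-\Delta/2,\Delta/2)$; vectors are quantized componentwise. The quantization interval is $[\overline z-U/2,\overline z+U/2]$. All dithers and all the random nodes $\ell$ below are mutually independent. **Algorithm.** Let $T\ge1$, $\eta>0$, $0<\kappa<1$ and $C_a,C_b,C_c,C_d>0$. Start with $\tilde x^{(0)}=0$, $\hat x^{(-1)}=0$, $\hat g^{(-1)}_i=0$. In outer iteration $s=0,1,2,\dots$, each node $i$ forms $\hat x^{(s)}_i=Q_a(\tilde x^{(s)}_i)$ (interval size $C_a\kappa^{(s+1)/2}$, midpoint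 $\hat x_i^{(s-1)}$), $g_i^{(s)}=\nabla f_i(\hat x^{(s)}_{\mathcal N_i})$, $\hat g_i^{(s)}=Q_b(g_i^{(s)})$ (size $C_b\kappa^{(s+1)/2}$, midpoint $\hat g_i^{(s-1)}$) and $\tilde h_i^{(s)}=\frac1N\sum_{j\in\mathcal N_i}\mathcal B_{ij}\hat g_j^{(s)}$. Put $x^{(s_0)}=\tilde x^{(s)}$. For $t=0,\dots,T-1$, a node $\ell$ is drawn uniformly from $\{1,\dots,N\}$; the nodes $i\in\mathcal N_\ell$ send $\hat x^{(s_t)}_i=Q_c(x^{(s_t)}_i)$ (size $C_c\kappa^{(s+1)/2}$, midpoint $\hat x_i^{(s)}$) to $\ell$; node $\ell$ computes $g_\ell^{(s_t)}=\nabla f_\ell(\hat x^{(s_t)}_{\mathcal N_\ell})$ and sends $\hat g_\ell^{(s_t)}=Q_d(g_\ell^{(s_t)})$ (size $C_d\kappa^{(s+1)/2}$, midpoint $\hat g_\ell^{(s)}$); and every node sets $x_i^{(s_{t+1})}=\operatorname{prox}_{R_i}(x_i^{(s_t)}-\eta v_i^{(s_t)})$, where $v_i^{(s_t)}=\mathcal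 B_{i\ell}\hat g_\ell^{(s_t)}-\mathcal B_{i\ell}\hat g_\ell^{(s)}+\tilde h_i^{(s)}$ if $i\in\mathcal N_\ell$ and $v_i^{(s_t)}=\tilde h_i^{(s)}$ otherwise. Finally $\tilde x^{(s+1)}=\frac1T\sum_{t=1}^Tx^{(s_t)}$. Reading $f_\ell$ as a function of the whole state, let $$e^{(s_t)}=v^{(s_t)}-\bigl(\nabla f_\ell(x^{(s_t)})-\nabla f_\ell(\tilde x^{(s)})+\nabla F(\tilde x^{(s)})\bigr),\qquad \Gamma^{(s)}=\sum_{t=0}^{T-1}\mathbf E\|e^{(s_t)}\|^2 .$$ **Theorem.** Let $p$ be given. Suppose that, almost surely, for all $1\le s\le p-1$ all the transmitted values $\tilde x_i^{(s)}$, $g_i^{(s)}$, $x_i^{(s_t)}$ ($i\in\mathcal N_\ell$) and $g_\ell^{(s_t)}$, $0\le t<T$, lie in the intervals of their quantizers. Then $\Gamma^{(k)}\le C\kappa^k$ for all $0\le k\le p-1$, where $$C=\frac{DT\overline m}{12(2^n-1)^2}\left(2\overline L^2(C_a^2+C_c^2)+2\,\frac{N+1}{N}\,C_b^2+C_d^2\right).$$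 If moreover $4\overline L\eta<1$ and, with $$\alpha=\frac1{\mu\eta(1-4\overline L\eta)T}+\frac{4\overline L\eta(T+1)}{(1-4\overline L\eta)T},\qquad \beta=\frac{\eta}{T(1-4\overline L\eta)},$$ we have $\alpha<\kappa$ (so $\alpha<\kappa<1$), then for all $0\le s\le p$ $$\mathbf E\bigl[G(\tilde x^{(s)})-G(x^\star)\bigr]\le\kappa^s\left(G(\tilde x^{(0)})-G(x^\star)+\frac{\beta C}{1-\alpha/\kappa}\right),$$ i.e. linear convergence at rate $\kappa$. -/

import Mathlib

open MeasureTheory ProbabilityTheory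
open scoped NNReal ENNReal

noncomputable section

namespace QuantSVRG

/-! ### Convex analysis: extended-real-valued functions -/

section Convex

variable {E : Type*} [NormedAddCommGroup E] [InnerProductSpace ℝ E]

/-- The effective domain `{x | R x < +∞}`. -/
def effDom (R : E → EReal) : Set E := {x | R x < ⊤}

/-- Convexity of an extended-real-valued function that never takes the value `-∞`. -/
def IsConvexFun (R : E → EReal) : Prop :=
  ∀ x y : E, ∀ a b : ℝ, 0 < a → 0 < b → a + b = 1 →
    R (a • x + b • y) ≤ (a : EReal) * R x + (b : EReal) * R y

/-- A regularizer: proper (never `-∞`, not identically `+∞`), lower semicontinuous, convex, with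
closed effective domain. -/
structure IsRegularizer (R : E → EReal) : Prop where
  ne_bot : ∀ x, R x ≠ ⊥
  dom_nonempty : (effDom R).Nonempty
  lsc : LowerSemicontinuous R
  convex : IsConvexFun R
  dom_closed : IsClosed (effDom R)

/-- `ξ ∈ ∂G(y)`. -/
def IsSubgradient (G : E → EReal) (ξ y : E) : Prop :=
  ∀ z : E, G y + ((inner ℝ ξ (z - y) : ℝ) : EReal) ≤ G z

/-- Strong convexity with parameter `μ`, through subgradients:
`G x ≥ G y + ξᵀ (x - y) + (μ/2) ‖x - y‖²` for `x, y` in the effective domain, `ξ ∈ ∂G(y)`. -/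
def IsStronglyConvex (μ : ℝ) (G : E → EReal) : Prop :=
  ∀ x ∈ effDom G, ∀ y ∈ effDom G, ∀ ξ : E, IsSubgradient G ξ y →
    G y + ((inner ℝ ξ (x - y) + μ / 2 * ‖x - y‖ ^ 2 : ℝ) : EReal) ≤ G x

/-- `prox(v) = argmin_y (1/2) ‖y - v‖² + η R(y)`. (The minimizer exists and is unique for every
regularizer `R` and `η > 0`; where no minimizer exists the value is unspecified.) -/
def prox (η : ℝ) (R : E → EReal) (v : E) : E :=
  Classical.epsilon fun y : E => ∀ z : E,
    ((1 / 2 * ‖y - v‖ ^ 2 : ℝ) : EReal) + (η : EReal) * R y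
      ≤ ((1 / 2 * ‖z - v‖ ^ 2 : ℝ) : EReal) + (η : EReal) * R z

end Convex

/-! ### The subtractively dithered quantizer -/

/-- The uniform quantizer with midpoint `zbar` and step size `Δ`. -/
def uniformQuant (zbar Δ z : ℝ) : ℝ :=
  zbar + Real.sign (z - zbar) * Δ * (⌊|z - zbar| / Δ + 1 / 2⌋ : ℝ)

/-- Subtractively dithered quantization of `z` with dither `ν`. -/
def ditherQuant (zbar Δ ν z : ℝ) : ℝ := uniformQuant zbar Δ (z + ν) - ν

/-! ### The network -/

section Network

variable {N : ℕ}

open Classical in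
/-- The neighbor set of node `i`: its neighbors in the graph and `i` itself. -/
def nbr (𝒢 : SimpleGraph (Fin N)) (i : Fin N) : Finset (Fin N) :=
  Finset.univ.filter fun j => j = i ∨ 𝒢.Adj i j

/-- The state of one node. -/
abbrev Block (m : Fin N → ℕ) (i : Fin N) : Type := EuclideanSpace ℝ (Fin (m i))

/-- The state `x = (x_1, …, x_N)` of the system, with the Euclidean norm of `ℝ^(m_1 + … + m_N)`. -/
abbrev State (m : Fin N → ℕ) : Type := PiLp 2 (fun i : Fin N => Block m i)

/-- The concatenation of the states of the nodes in the neighbor set of `i`. -/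
abbrev LocalState (m : Fin N → ℕ) (𝒢 : SimpleGraph (Fin N)) (i : Fin N) : Type :=
  PiLp 2 (fun j : {j : Fin N // j ∈ nbr 𝒢 i} => Block m j.1)

variable {m : Fin N → ℕ} {𝒢 : SimpleGraph (Fin N)}

/-- The selection map from `x` to the states of the neighbor set of `i`. -/
def select (𝒢 : SimpleGraph (Fin N)) (i : Fin N) (x : State m) : LocalState m 𝒢 i :=
  WithLp.toLp 2 fun j => x j.1

open Classical in
/-- The block belonging to node `i` of a local vector of node `j` (zero if `i` is not in the
neighbor set of `j`). -/
def comp (i j : Fin N) (y : LocalState m 𝒢 j) : Block m i :=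
  if h : i ∈ nbr 𝒢 j then y ⟨i, h⟩ else 0

end Network

/-- The data of the distributed algorithm on `N` nodes. -/
structure Setup (N : ℕ) where
  /-- dimensions of the node states -/
  m : Fin N → ℕ
  /-- communication graph -/
  graph : SimpleGraph (Fin N)
  /-- local objectives -/
  f : ∀ i : Fin N, LocalState m graph i → ℝ
  /-- regularizer of the whole state -/
  R : State m → EReal
  /-- regularizers that the single nodes use in their local proximal steps -/
  Rloc : ∀ i : Fin N, Block m i → EReal
  /-- inner loop size -/
  T : ℕ
  /-- step size -/
  η : ℝ
  /-- refinement factor of the quantization intervals -/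
  κ : ℝ
  /-- number of bits per quantized number -/
  bits : ℕ
  Ca : ℝ
  Cb : ℝ
  Cc : ℝ
  Cd : ℝ

/-- Labels of the dither variables: one for each scalar that can be quantized by the quantizers
`Q_a, Q_b` in outer iteration `s`, and by `Q_c, Q_d` in inner iteration `t` of it. For the
gradients, `(j, k)` is the `k`-th coordinate of the block of node `j` in the gradient of
node `i`. -/
inductive DitherIndex {N : ℕ} (m : Fin N → ℕ) : Type
  | a (s : ℕ) (i : Fin N) (k : Fin (m i))
  | b (s : ℕ) (i j : Fin N) (k : Fin (m j))
  | c (s t : ℕ) (i : Fin N) (k : Fin (m i))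
  | d (s t : ℕ) (i j : Fin N) (k : Fin (m j))

namespace Setup

variable {N : ℕ} (S : Setup N)

/-- `F(x) = (1/N) ∑ f_i(x_{N_i})`. -/
def F (x : State S.m) : ℝ := (1 / N : ℝ) * ∑ i, S.f i (select S.graph i x)

/-- The objective `G = F + R`. -/
def G (x : State S.m) : EReal := (S.F x : EReal) + S.R x

/-- Largest size of a neighbor set. -/
def D : ℕ := Finset.univ.sup fun i => (nbr S.graph i).card

/-- Largest dimension of a node state. -/
def mbar : ℕ := Finset.univ.sup S.m

/-- Quantization interval sizes in outer iteration `s`: `C κ^((s+1)/2)`. -/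
def U (C : ℝ) (s : ℕ) : ℝ := C * S.κ ^ (((s : ℝ) + 1) / 2)

/-- Quantization step size for an interval of size `C κ^((s+1)/2)`. -/
def step (C : ℝ) (s : ℕ) : ℝ := S.U C s / (2 ^ S.bits - 1)

/-- Step size of the quantizer that a dither variable belongs to. -/
def ditherStep : DitherIndex S.m → ℝ
  | .a s _ _ => S.step S.Ca s
  | .b s _ _ _ => S.step S.Cb s
  | .c s _ _ _ => S.step S.Cc s
  | .d s _ _ _ _ => S.step S.Cd s

/-! #### The algorithm, along one realization `ν` of the dithers and `ell` of the random nodes -/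

/-- What the nodes hold at the beginning of outer iteration `s`: the iterate `x̃^(s)` and the
quantized iterate and quantized gradients of outer iteration `s - 1`. -/
structure Outer where
  x : State S.m
  xhat : State S.m
  ghat : ∀ i, LocalState S.m S.graph i

/-- Initialization: everything is zero. -/
def init : S.Outer := ⟨0, 0, fun _ => 0⟩

variable (ν : DitherIndex S.m → ℝ) (ell : ℕ → ℕ → Fin N)

/-- Quantized iterate of outer iteration `s`. -/
def xhat (s : ℕ) (o : S.Outer) : State S.m :=
  WithLp.toLp 2 fun i => WithLp.toLp 2 fun k =>
    ditherQuant (o.xhat i k) (S.step S.Ca s) (ν (.a s i k)) (o.x i k)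

/-- Gradient of `f_i` at the quantized iterate of outer iteration `s`. -/
def grad (s : ℕ) (o : S.Outer) (i : Fin N) : LocalState S.m S.graph i :=
  gradient (S.f i) (select S.graph i (S.xhat ν s o))

/-- Quantized gradients of outer iteration `s`. -/
def ghat (s : ℕ) (o : S.Outer) (i : Fin N) : LocalState S.m S.graph i :=
  WithLp.toLp 2 fun j => WithLp.toLp 2 fun k =>
    ditherQuant (o.ghat i j k) (S.step S.Cb s) (ν (.b s i j.1 k)) (S.grad ν s o i j k)

/-- Node `i`'s block of the full gradient estimate. -/
def htil (s : ℕ) (o : S.Outer) (i : Fin N) : Block S.m i :=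
  (1 / N : ℝ) • ∑ j ∈ nbr S.graph i, comp i j (S.ghat ν s o j)

/-- The correction `v_{ij}` that node `i` stores for its neighbor `j`. -/
def vcorr (s : ℕ) (o : S.Outer) (i j : Fin N) : Block S.m i :=
  -comp i j (S.ghat ν s o j) + S.htil ν s o i

/-- Quantized state in inner iteration `t`; only the blocks of the nodes in the neighbor set of
the chosen node are ever used. -/
def xhatIn (s t : ℕ) (o : S.Outer) (x : State S.m) : State S.m :=
  WithLp.toLp 2 fun i => WithLp.toLp 2 fun k =>
    ditherQuant (S.xhat ν s o i k) (S.step S.Cc s) (ν (.c s t i k)) (x i k)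

/-- Gradient computed by node `l` in inner iteration `t`. -/
def gradIn (s t : ℕ) (o : S.Outer) (x : State S.m) (l : Fin N) : LocalState S.m S.graph l :=
  gradient (S.f l) (select S.graph l (S.xhatIn ν s t o x))

/-- The quantized gradient sent by node `l` in inner iteration `t`. -/
def ghatIn (s t : ℕ) (o : S.Outer) (x : State S.m) (l : Fin N) : LocalState S.m S.graph l :=
  WithLp.toLp 2 fun j => WithLp.toLp 2 fun k =>
    ditherQuant (S.ghat ν s o l j k) (S.step S.Cd s) (ν (.d s t l j.1 k))
      (S.gradIn ν s t o x l j k)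

open Classical in
/-- The direction used in inner iteration `t`, node by node: neighbors of the chosen node use its
new quantized gradient, the other nodes use the full gradient estimate. -/
def dir (s t : ℕ) (o : S.Outer) (x : State S.m) : State S.m :=
  WithLp.toLp 2 fun i =>
    if i ∈ nbr S.graph (ell s t) then
      comp i (ell s t) (S.ghatIn ν s t o x (ell s t)) + S.vcorr ν s o i (ell s t)
    else S.htil ν s o i

/-- The iterates of the inner loop of outer iteration `s`. -/
def inner (s : ℕ) (o : S.Outer) : ℕ → State S.m
  | 0 => o.x
  | t + 1 => WithLp.toLp 2 fun i =>
      prox S.η (S.Rloc i) (inner s o t i - S.η • S.dir ν ell s t o (inner s o t) i)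

/-- The outer loop. -/
def outer : ℕ → S.Outer
  | 0 => S.init
  | s + 1 =>
    { x := (1 / S.T : ℝ) • ∑ t ∈ Finset.range S.T, S.inner ν ell s (outer s) (t + 1)
      xhat := S.xhat ν s (outer s)
      ghat := S.ghat ν s (outer s) }

/-- The outer iterate `x̃^(s)`. -/
def xtilde (s : ℕ) : State S.m := (S.outer ν ell s).x

/-- The inner iterate `x^(s_t)`. -/
def xin (s t : ℕ) : State S.m := S.inner ν ell s (S.outer ν ell s) t

/-- The gradient error `e^(s_t)`: the direction used in inner iteration `t` of outer iteration `s`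
minus the exact semi-stochastic direction `∇f_ℓ(x^(s_t)) - ∇f_ℓ(x̃^(s)) + ∇F(x̃^(s))`, where the
local objectives are read as functions of the whole state. -/
def err (s t : ℕ) : State S.m :=
  S.dir ν ell s t (S.outer ν ell s) (S.xin ν ell s t)
    - (gradient (fun x => S.f (ell s t) (select S.graph (ell s t) x)) (S.xin ν ell s t)
        - gradient (fun x => S.f (ell s t) (select S.graph (ell s t) x)) (S.xtilde ν ell s)
        + gradient S.F (S.xtilde ν ell s))

/-- All values transmitted during outer iteration `s` lie in the intervals of their quantizers. -/
def InRange (s : ℕ) : Prop :=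
  let o := S.outer ν ell s
  (∀ i k, |o.x i k - o.xhat i k| ≤ S.U S.Ca s / 2) ∧
  (∀ i j k, |S.grad ν s o i j k - o.ghat i j k| ≤ S.U S.Cb s / 2) ∧
  ∀ t < S.T,
    (∀ i ∈ nbr S.graph (ell s t), ∀ k,
      |S.xin ν ell s t i k - S.xhat ν s o i k| ≤ S.U S.Cc s / 2) ∧
    (∀ j k, |S.gradIn ν s t o (S.xin ν ell s t) (ell s t) j k
        - S.ghat ν s o (ell s t) j k| ≤ S.U S.Cd s / 2)

/-! #### Constants -/

/-- `α` for strong convexity parameter `μ` and Lipschitz constant `L`. -/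
def alpha (μ L : ℝ) : ℝ :=
  1 / (μ * S.η * (1 - 4 * L * S.η) * S.T)
    + 4 * L * S.η * (S.T + 1) / ((1 - 4 * L * S.η) * S.T)

/-- `β` for Lipschitz constant `L`. -/
def beta (L : ℝ) : ℝ := S.η / (S.T * (1 - 4 * L * S.η))

/-- The constant in the bound of the error sums, for Lipschitz constant `L`. -/
def Cerr (L : ℝ) : ℝ :=
  S.D * S.T * S.mbar / (12 * (2 ^ S.bits - 1) ^ 2)
    * (2 * L ^ 2 * (S.Ca ^ 2 + S.Cc ^ 2) + 2 * ((N + 1) / N) * S.Cb ^ 2 + S.Cd ^ 2)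

/-! #### Randomness and expectations -/

/-- The random inputs of the algorithm: each dither is uniform on `(-Δ/2, Δ/2)` with `Δ` the step
size of its quantizer, each chosen node is uniform on the `N` nodes, and all of these random
variables are mutually independent. -/
structure IsRandomInput {Ω : Type*} [MeasurableSpace Ω] (P : Measure Ω)
    (ν : DitherIndex S.m → Ω → ℝ) (ell : ℕ → ℕ → Ω → Fin N) : Prop where
  measurable_dither : ∀ q, Measurable (ν q)
  measurable_node : ∀ s t, Measurable (ell s t)
  uniform_dither : ∀ q,
    pdf.IsUniform (ν q) (Set.Ioo (-(S.ditherStep q) / 2) (S.ditherStep q / 2)) P volume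
  uniform_node : ∀ s t l, P {ω | ell s t ω = l} = (N : ℝ≥0∞)⁻¹
  indep_dither : iIndepFun ν P
  indep_node : iIndepFun (fun (q : ℕ × ℕ) ω => ell q.1 q.2 ω) P
  indep_dither_node : IndepFun (fun ω q => ν q ω) (fun ω (q : ℕ × ℕ) => ell q.1 q.2 ω) P

/-- `Γ^(k) = ∑_{t < T} E ‖e^(k_t)‖²`. -/
def Gam {Ω : Type*} [MeasurableSpace Ω] (P : Measure Ω)
    (ν : DitherIndex S.m → Ω → ℝ) (ell : ℕ → ℕ → Ω → Fin N) (k : ℕ) : ℝ≥0∞ :=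
  ∑ t ∈ Finset.range S.T,
    ∫⁻ ω, ENNReal.ofReal (‖S.err (fun q => ν q ω) (fun a b => ell a b ω) k t‖ ^ 2) ∂P

/-- `E[G(x̃^(s)) - G(x⋆)]` for a minimizer `x⋆` of `G` (the expectation of a nonnegative
extended-real random variable). -/
def expGap {Ω : Type*} [MeasurableSpace Ω] (P : Measure Ω)
    (ν : DitherIndex S.m → Ω → ℝ) (ell : ℕ → ℕ → Ω → Fin N) (xstar : State S.m) (s : ℕ) :
    ℝ≥0∞ :=
  ∫⁻ ω, (S.G (S.xtilde (fun q => ν q ω) (fun a b => ell a b ω) s) - S.G xstar).toENNReal ∂P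

end Setup

end QuantSVRG

end

open QuantSVRG

open QuantSVRG

/-!
The proof compares the algorithm with exact proximal gradient descent and treats everything else
as noise.

*Quantization noise.* The error of a dithered quantizer is a sawtooth function of value plus
dither, so it is uniform on an interval of length `Δ` whatever the value and the midpoint are
(`integral_uniform_ditherQuant`). If the value and the midpoint do not depend on the dither, the
error therefore has second moment `Δ² / 12` and is orthogonal to every quantity that does not
depend on that dither (`IsDitherErr.integral_mul`). Moreover the error never exceeds `Δ / 2`, so all
iterates are bounded and integrability is not an issue (`BddMeas`). Since the gradients are affine,
an error `ε` of the state changes the gradient of node `l` by `H_l ε`, and the noise of a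
transmitted gradient is a linear image of independent dither errors (`anchorNoise_eq`,
`innerNoise_eq`).

*The direction.* With `ℓ` the chosen node, the algorithm's direction minus `∇F(x^(s_t))` equals
`A_ℓ + (u_ℓ - mean u)`, where `A_l` is the noise of the gradient sent in the inner iteration and
`u_l` is the exact local gradient at `x^(s_t)` minus the quantized one at `x̃^(s)`
(`dir_sub_gradient_eq`). As `ℓ` is uniform and independent of the past, this is unbiased and its
second moment is at most the mean over `l` of `E‖A_l‖² + E‖u_l‖²`
(`integral_norm_sq_estimator_le`); the same lemma, with `u_l` replaced by the noise `Y_l` of the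
gradients at `x̃^(s)`, bounds the error `e^(s_t)`. For the convergence rate a little care is needed,
since `Y_l` is correlated with the inner iterates. It is uncorrelated with `x̃^(s)`, though.
Writing `u_l` as the gradient increment from `x⋆` to `x^(s_t)` minus the sum of `Y_l` and the
increment from `x⋆` to `x̃^(s)` and using `‖a - b‖² ≤ 2‖a‖² + 2‖b‖²`, the cross term with `Y_l`
vanishes in expectation, and `Y_l` counts twice. The constant `C` has room for that
(`noise_budget`).

*Convergence.* The rest is the analysis of the proximal stochastic variance reduced gradient
method: cocoercivity bounds the gradient increments by the optimality gap
(`sum_norm_gradient_sub_sq_le`), the inner iterations are summed, strong convexity bounds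
`‖x̃^(s) - x⋆‖²` by the gap, and averaging yields the recursion
`a_(s+1) ≤ α a_s + β C κ^(s+1)` (`integral_gap_xtilde_succ_le`). If `0` is not in the domain of the
regularizer, the initial gap and hence the bound are infinite.
-/

namespace QuantSVRG

/-! ### Convex functions with Lipschitz gradient -/

section Smooth

variable {E : Type*} [NormedAddCommGroup E] [InnerProductSpace ℝ E] [CompleteSpace E]

lemma hasDerivAt_comp_line {f : E → ℝ} (hf : Differentiable ℝ f) (x d : E) (t : ℝ) :
    HasDerivAt (fun t : ℝ => f (x + t • d)) (inner ℝ (gradient f (x + t • d)) d) t := by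
  have h1 : HasDerivAt (fun t : ℝ => x + t • d) d t := by
    simpa using ((hasDerivAt_id t).smul_const d).const_add x
  have h2 := (hf (x + t • d)).hasGradientAt.hasFDerivAt
  exact (h2.comp_hasDerivAt t h1).congr_deriv (by simp)

/-- The quadratic upper bound for a function with Lipschitz gradient. -/
lemma le_quadratic_of_lipschitz_gradient {f : E → ℝ} (hf : Differentiable ℝ f) {L : ℝ≥0}
    (hL : LipschitzWith L (gradient f)) (x y : E) :
    f y ≤ f x + inner ℝ (gradient f x) (y - x) + L / 2 * ‖y - x‖ ^ 2 := by
  set d := y - x with hd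
  let h : ℝ → ℝ := fun t => f (x + t • d) - t * inner ℝ (gradient f x) d - L / 2 * t ^ 2 * ‖d‖ ^ 2
  have hder : ∀ t, HasDerivAt h
      (inner ℝ (gradient f (x + t • d)) d - inner ℝ (gradient f x) d - L * t * ‖d‖ ^ 2) t := by
    intro t
    have h1 := hasDerivAt_comp_line hf x d t
    have h2 := (hasDerivAt_id t).mul_const (inner ℝ (gradient f x) d)
    have h3 := (((hasDerivAt_id t).pow 2).const_mul ((L : ℝ) / 2)).mul_const (‖d‖ ^ 2)
    refine ((h1.sub h2).sub h3).congr_deriv ?_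
    simp only [id]
    push_cast
    ring
  have hanti : AntitoneOn h (Set.Icc 0 1) := by
    refine antitoneOn_of_deriv_nonpos (convex_Icc 0 1)
      (fun t _ => (hder t).continuousAt.continuousWithinAt)
      (fun t _ => (hder t).differentiableAt.differentiableWithinAt) ?_
    intro t ht
    rw [interior_Icc] at ht
    rw [(hder t).deriv, ← inner_sub_left]
    have h1 := real_inner_le_norm (gradient f (x + t • d) - gradient f x) d
    have h2 := hL.norm_sub_le (x + t • d) x
    rw [add_sub_cancel_left, norm_smul, Real.norm_of_nonneg ht.1.le] at h2
    nlinarith [norm_nonneg d]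
  have := hanti (by simp) (by simp) zero_le_one
  simp only [h, one_smul, zero_smul, add_zero] at this
  have hy : x + d = y := by simp [hd]
  rw [hy] at this
  linarith

lemma le_of_convexOn_gradient {f : E → ℝ} (hf : Differentiable ℝ f)
    (hc : ConvexOn ℝ Set.univ f) (x y : E) :
    f x + inner ℝ (gradient f x) (y - x) ≤ f y := by
  have hd := hasDerivAt_comp_line hf x (y - x) 0
  have hg : ConvexOn ℝ Set.univ (fun t : ℝ => f (x + t • (y - x))) := by
    have := hc.comp_affineMap (AffineMap.lineMap x y : ℝ →ᵃ[ℝ] E)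
    simpa [Function.comp_def, AffineMap.lineMap_apply, add_comm] using this
  have := hg.le_slope_of_hasDerivAt (Set.mem_univ 0) (Set.mem_univ 1) zero_lt_one hd
  simp only [slope, zero_smul, add_zero, one_smul, sub_zero, inv_one, vsub_eq_sub,
    add_sub_cancel] at this
  linarith

/-- Cocoercivity of the gradient of a convex function with Lipschitz gradient. -/
lemma norm_gradient_sub_sq_le {f : E → ℝ} (hf : Differentiable ℝ f)
    (hc : ConvexOn ℝ Set.univ f) {L : ℝ≥0} (hL : LipschitzWith L (gradient f)) (x y : E) :
    ‖gradient f x - gradient f y‖ ^ 2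
      ≤ 2 * L * (f x - f y - inner ℝ (gradient f y) (x - y)) := by
  rcases eq_or_ne L 0 with h0 | h0
  · have := hL.norm_sub_le x y
    subst h0
    have h1 : ‖gradient f x - gradient f y‖ = 0 :=
      le_antisymm (by simpa using this) (norm_nonneg _)
    rw [h1]
    simp
  have hpos : (0 : ℝ) < L := by positivity
  set u := gradient f x - gradient f y with hu
  -- The gradient step of length `1 / L` from `x` for `f - ⟨∇f y, ·⟩`.
  set z := x - (1 / (L : ℝ)) • u with hz
  have h1 := le_of_convexOn_gradient hf hc y z
  have h2 := le_quadratic_of_lipschitz_gradient hf hL x z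
  have e1 : z - x = -((1 / (L : ℝ)) • u) := by simp [hz]
  have e2 : z - y = (x - y) + (z - x) := by abel
  rw [e2, inner_add_right] at h1
  have e3 : inner ℝ (gradient f x) (z - x) = inner ℝ u (z - x) + inner ℝ (gradient f y) (z - x) := by
    rw [hu, inner_sub_left]; ring
  have e4 : inner ℝ u (z - x) = -(1 / L * ‖u‖ ^ 2) := by
    rw [e1, inner_neg_right, inner_smul_right, real_inner_self_eq_norm_sq]
  have e5 : ‖z - x‖ ^ 2 = (1 / L) ^ 2 * ‖u‖ ^ 2 := by
    rw [e1, norm_neg, norm_smul, mul_pow, Real.norm_of_nonneg (by positivity)]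
  rw [e3, e4, e5] at h2
  have e6 : (L : ℝ) / 2 * ((1 / L) ^ 2 * ‖u‖ ^ 2) = 1 / L * ‖u‖ ^ 2 / 2 := by
    field_simp
  have h3 : 1 / (L : ℝ) * ‖u‖ ^ 2 ≤ 2 * (f x - f y - inner ℝ (gradient f y) (x - y)) := by
    linarith
  calc ‖u‖ ^ 2 = L * (1 / L * ‖u‖ ^ 2) := by field_simp
    _ ≤ L * (2 * (f x - f y - inner ℝ (gradient f y) (x - y))) := by gcongr
    _ = _ := by ring

end Smooth

section Minimizers

variable {E : Type*} [NormedAddCommGroup E] [InnerProductSpace ℝ E]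

lemma nonneg_of_forall_small {K M : ℝ} (h : ∀ l : ℝ, 0 < l → l ≤ 1 → 0 ≤ K + l * M) : 0 ≤ K := by
  by_contra! hK
  have hM : 0 < |M| + 1 := by positivity
  have hpos : 0 < min 1 (-K / (2 * (|M| + 1))) :=
    lt_min one_pos (div_pos (by linarith) (by positivity))
  have h1 := h _ hpos (min_le_left _ _)
  have h2 := min_le_right 1 (-K / (2 * (|M| + 1)))
  set l := min 1 (-K / (2 * (|M| + 1)))
  rw [le_div_iff₀ (by positivity)] at h2
  nlinarith [le_abs_self M]

/-- First-order optimality condition for the sum of a function that has a quadratic upper bound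
at the minimizer and a convex function. -/
lemma IsMinOn_add_variational {s : Set E} {φ ρ : E → ℝ} (hρ : ConvexOn ℝ s ρ) {g y : E} {c : ℝ}
    (hφ : ∀ z, φ z ≤ φ y + inner ℝ g (z - y) + c * ‖z - y‖ ^ 2) (hy : y ∈ s)
    (hmin : ∀ z ∈ s, φ y + ρ y ≤ φ z + ρ z) {z : E} (hz : z ∈ s) :
    ρ y ≤ ρ z + inner ℝ g (z - y) := by
  suffices 0 ≤ ρ z - ρ y + inner ℝ g (z - y) by linarith
  refine nonneg_of_forall_small (M := c * ‖z - y‖ ^ 2) fun l hl hl1 => ?_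
  have e : (1 - l) • y + l • z = y + l • (z - y) := by module
  have hmem := hρ.1 hy hz (sub_nonneg.2 hl1) hl.le (by ring)
  have h1 := hρ.2 hy hz (sub_nonneg.2 hl1) hl.le (by ring)
  have h2 := hmin _ hmem
  rw [e] at h1 h2
  have h3 := hφ (y + l • (z - y))
  rw [add_sub_cancel_left, inner_smul_right, norm_smul, mul_pow, Real.norm_of_nonneg hl.le] at h3
  simp only [smul_eq_mul] at h1
  have h4 : 0 ≤ l * (ρ z - ρ y + inner ℝ g (z - y) + l * (c * ‖z - y‖ ^ 2)) := by nlinarith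
  exact nonneg_of_mul_nonneg_right h4 hl

end Minimizers

/-! ### Regularizers and the proximal operation -/

section Regularizer

variable {E : Type*} [NormedAddCommGroup E] [InnerProductSpace ℝ E] {R : E → EReal}

lemma IsRegularizer.coe_toReal (hR : IsRegularizer R) {x : E} (hx : x ∈ effDom R) :
    ((R x).toReal : EReal) = R x :=
  EReal.coe_toReal (ne_of_lt hx) (hR.ne_bot x)

lemma IsRegularizer.eq_top (_hR : IsRegularizer R) {x : E} (hx : x ∉ effDom R) : R x = ⊤ :=
  not_lt_top_iff.1 hx

lemma IsRegularizer.convexOn (hR : IsRegularizer R) :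
    ConvexOn ℝ (effDom R) (fun x => (R x).toReal) := by
  have key : ∀ x ∈ effDom R, ∀ y ∈ effDom R, ∀ a b : ℝ, 0 < a → 0 < b → a + b = 1 →
      R (a • x + b • y) ≤ ((a * (R x).toReal + b * (R y).toReal : ℝ) : EReal) := by
    intro x hx y hy a b ha hb hab
    have := hR.convex x y a b ha hb hab
    rw [← hR.coe_toReal hx, ← hR.coe_toReal hy] at this
    exact_mod_cast this
  have hmem : ∀ x ∈ effDom R, ∀ y ∈ effDom R, ∀ a b : ℝ, 0 < a → 0 < b → a + b = 1 →
      a • x + b • y ∈ effDom R := fun x hx y hy a b ha hb hab =>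
    (key x hx y hy a b ha hb hab).trans_lt (EReal.coe_lt_top _)
  refine convexOn_iff_forall_pos.2 ⟨convex_iff_forall_pos.2 ?_, ?_⟩
  · intro x hx y hy a b ha hb hab
    exact hmem x hx y hy a b ha hb hab
  · intro x hx y hy a b ha hb hab
    have h1 := key x hx y hy a b ha hb hab
    rw [← hR.coe_toReal (hmem x hx y hy a b ha hb hab)] at h1
    simpa using (EReal.coe_le_coe_iff.1 h1)

lemma IsRegularizer.lowerSemicontinuousOn (hR : IsRegularizer R) :
    LowerSemicontinuousOn (fun x => (R x).toReal) (effDom R) := by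
  intro x hx c hc
  have h1 : (c : EReal) < R x := by
    rw [← hR.coe_toReal hx]; exact_mod_cast hc
  have h2 := hR.lsc x c h1
  filter_upwards [nhdsWithin_le_nhds h2, self_mem_nhdsWithin] with y hy hy2
  have : (c : EReal) < ((R y).toReal : EReal) := by rwa [hR.coe_toReal hy2]
  exact_mod_cast this

variable [FiniteDimensional ℝ E]

/-- A regularizer is bounded below by a linear function of the distance to a point of its
domain: convexity propagates the lower bound on the unit ball around that point. -/
lemma IsRegularizer.exists_linear_lower_bound (hR : IsRegularizer R) {x₀ : E}
    (hx₀ : x₀ ∈ effDom R) :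
    ∃ c : ℝ, 0 ≤ c ∧ |(R x₀).toReal| ≤ c ∧
      ∀ z ∈ effDom R, 1 ≤ ‖z - x₀‖ → -(c * ‖z - x₀‖) ≤ (R z).toReal := by
  have : ProperSpace E := FiniteDimensional.proper_real E
  have hK : IsCompact (effDom R ∩ Metric.closedBall x₀ 1) :=
    (isCompact_closedBall x₀ 1).inter_left hR.dom_closed
  have hne : (effDom R ∩ Metric.closedBall x₀ 1).Nonempty :=
    ⟨x₀, hx₀, Metric.mem_closedBall_self zero_le_one⟩
  obtain ⟨y, hy, hmin⟩ := LowerSemicontinuousOn.exists_isMinOn hne hK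
    (hR.lowerSemicontinuousOn.mono Set.inter_subset_left)
  refine ⟨|(R y).toReal| + |(R x₀).toReal|, by positivity, by simp, fun z hz ht => ?_⟩
  set t := ‖z - x₀‖ with htdef
  have ht0 : 0 < t := by linarith
  have ht1 : 1 / t ≤ 1 := by rw [div_le_one ht0]; exact ht
  have hcv := hR.convexOn
  have hmem := hcv.1 hx₀ hz (sub_nonneg.2 ht1) (by positivity : 0 ≤ 1 / t) (by ring)
  have hle := hcv.2 hx₀ hz (sub_nonneg.2 ht1) (by positivity : 0 ≤ 1 / t) (by ring)
  have hball : (1 - 1 / t) • x₀ + (1 / t) • z ∈ Metric.closedBall x₀ 1 := by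
    have : (1 - 1 / t) • x₀ + (1 / t) • z - x₀ = (1 / t) • (z - x₀) := by module
    rw [mem_closedBall_iff_norm, this, norm_smul, Real.norm_of_nonneg (by positivity), ← htdef]
    field_simp
    exact le_rfl
  have h1 : (R y).toReal ≤ _ := hmin ⟨hmem, hball⟩
  have h2 := h1.trans hle
  simp only [smul_eq_mul] at h2
  have h3 : t * (R y).toReal ≤ (t - 1) * (R x₀).toReal + (R z).toReal := by
    calc t * (R y).toReal ≤ t * ((1 - 1 / t) * (R x₀).toReal + 1 / t * (R z).toReal) := by gcongr
      _ = _ := by field_simp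
  nlinarith [neg_abs_le (R y).toReal, le_abs_self (R x₀).toReal, abs_nonneg (R x₀).toReal]

/-- The minimization problem defining `prox` has a solution. -/
lemma IsRegularizer.exists_prox (hR : IsRegularizer R) {η : ℝ} (hη : 0 < η) (v : E) :
    ∃ y ∈ effDom R, ∀ z ∈ effDom R,
      1 / 2 * ‖y - v‖ ^ 2 + η * (R y).toReal ≤ 1 / 2 * ‖z - v‖ ^ 2 + η * (R z).toReal := by
  have : ProperSpace E := FiniteDimensional.proper_real E
  obtain ⟨x₀, hx₀⟩ := hR.dom_nonempty
  obtain ⟨c, hc0, hc, hlow⟩ := hR.exists_linear_lower_bound hx₀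
  set a := ‖x₀ - v‖ with ha
  set ρ := 2 * (a + η * c) + 2 * (η * c) + 1 with hρ
  have ha0 : 0 ≤ a := norm_nonneg _
  have hηc : 0 ≤ η * c := by positivity
  have hK : IsCompact (effDom R ∩ Metric.closedBall x₀ ρ) :=
    (isCompact_closedBall x₀ ρ).inter_left hR.dom_closed
  have hx₀ρ : x₀ ∈ Metric.closedBall x₀ ρ := Metric.mem_closedBall_self (by positivity)
  have hlsc : LowerSemicontinuousOn (fun z => 1 / 2 * ‖z - v‖ ^ 2 + η * (R z).toReal)
      (effDom R) := by
    have h1 : Continuous fun z : E => 1 / 2 * ‖z - v‖ ^ 2 := by fun_prop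
    exact LowerSemicontinuousOn.add (h1.lowerSemicontinuous.lowerSemicontinuousOn _)
      ((continuous_const_mul η).comp_lowerSemicontinuousOn hR.lowerSemicontinuousOn
        (fun x y hxy => mul_le_mul_of_nonneg_left hxy hη.le))
  have hne : (effDom R ∩ Metric.closedBall x₀ ρ).Nonempty := ⟨x₀, hx₀, hx₀ρ⟩
  obtain ⟨y, hy, hmin⟩ := LowerSemicontinuousOn.exists_isMinOn hne hK
    (hlsc.mono Set.inter_subset_left)
  refine ⟨y, hy.1, fun z hz => ?_⟩
  by_cases hzρ : z ∈ Metric.closedBall x₀ ρ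
  · exact hmin ⟨hz, hzρ⟩
  -- far from `x₀` the quadratic term dominates the linear lower bound
  refine (show _ ≤ 1 / 2 * ‖x₀ - v‖ ^ 2 + η * (R x₀).toReal from hmin ⟨hx₀, hx₀ρ⟩).trans ?_
  rw [mem_closedBall_iff_norm, not_le] at hzρ
  set t := ‖z - x₀‖ with ht
  have h1 := hlow z hz (by linarith)
  have h2 : t - a ≤ ‖z - v‖ := by
    have := norm_sub_norm_le (z - x₀) (v - x₀)
    rw [sub_sub_sub_cancel_right, norm_sub_rev v x₀] at this
    exact this
  have h3 : (t - a) ^ 2 ≤ ‖z - v‖ ^ 2 := by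
    have : 0 ≤ t - a := by linarith
    gcongr
  have h4 : η * -(c * t) ≤ η * (R z).toReal := by gcongr
  have h5 : η * (R x₀).toReal ≤ η * c := by
    have := (le_abs_self _).trans hc
    gcongr
  have h6 : η * c ≤ 1 / 2 * t - a - η * c := by linarith
  have h7 : 1 * (η * c) ≤ t * (1 / 2 * t - a - η * c) :=
    mul_le_mul (by linarith) h6 hηc (by linarith)
  rw [← ha]
  nlinarith

lemma IsRegularizer.prox_spec (hR : IsRegularizer R) {η : ℝ} (hη : 0 < η) (v : E) :
    prox η R v ∈ effDom R ∧ ∀ z ∈ effDom R,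
      1 / 2 * ‖prox η R v - v‖ ^ 2 + η * (R (prox η R v)).toReal
        ≤ 1 / 2 * ‖z - v‖ ^ 2 + η * (R z).toReal := by
  have hcoe : ∀ z ∈ effDom R, ((1 / 2 * ‖z - v‖ ^ 2 : ℝ) : EReal) + (η : EReal) * R z
      = ((1 / 2 * ‖z - v‖ ^ 2 + η * (R z).toReal : ℝ) : EReal) := by
    intro z hz
    rw [EReal.coe_add, EReal.coe_mul η, hR.coe_toReal hz]
  have htop : ∀ z ∉ effDom R, ((1 / 2 * ‖z - v‖ ^ 2 : ℝ) : EReal) + (η : EReal) * R z = ⊤ := by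
    intro z hz
    rw [hR.eq_top hz, EReal.coe_mul_top_of_pos hη, EReal.coe_add_top]
  have hex : ∃ y : E, ∀ z : E, ((1 / 2 * ‖y - v‖ ^ 2 : ℝ) : EReal) + (η : EReal) * R y
      ≤ ((1 / 2 * ‖z - v‖ ^ 2 : ℝ) : EReal) + (η : EReal) * R z := by
    obtain ⟨y, hy, hmin⟩ := hR.exists_prox hη v
    refine ⟨y, fun z => ?_⟩
    by_cases hz : z ∈ effDom R
    · rw [hcoe y hy, hcoe z hz]
      exact_mod_cast hmin z hz
    · rw [htop z hz]; exact le_top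
  have hspec := Classical.epsilon_spec hex
  change ∀ z : E, ((1 / 2 * ‖prox η R v - v‖ ^ 2 : ℝ) : EReal) + (η : EReal) * R (prox η R v)
      ≤ ((1 / 2 * ‖z - v‖ ^ 2 : ℝ) : EReal) + (η : EReal) * R z at hspec
  have hmem : prox η R v ∈ effDom R := by
    by_contra hn
    obtain ⟨x₀, hx₀⟩ := hR.dom_nonempty
    have := hspec x₀
    rw [htop _ hn, hcoe x₀ hx₀, top_le_iff] at this
    exact EReal.coe_ne_top _ this
  refine ⟨hmem, fun z hz => ?_⟩
  have := hspec z
  rw [hcoe _ hmem, hcoe z hz] at this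
  exact_mod_cast this

lemma IsRegularizer.prox_mem (hR : IsRegularizer R) {η : ℝ} (hη : 0 < η) (v : E) :
    prox η R v ∈ effDom R := (hR.prox_spec hη v).1

/-- The variational inequality of the proximal operation: `(v - prox v) / η ∈ ∂R(prox v)`. -/
lemma IsRegularizer.prox_variational (hR : IsRegularizer R) {η : ℝ} (hη : 0 < η) (v : E) {z : E}
    (hz : z ∈ effDom R) :
    η * (R (prox η R v)).toReal
      ≤ η * (R z).toReal + inner ℝ (prox η R v - v) (z - prox η R v) := by
  obtain ⟨hmem, hmin⟩ := hR.prox_spec hη v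
  set y := prox η R v
  refine IsMinOn_add_variational (φ := fun z => 1 / 2 * ‖z - v‖ ^ 2) (c := 1 / 2)
    (ρ := fun z => η * (R z).toReal) (by simpa using hR.convexOn.smul hη.le) ?_ hmem hmin hz
  intro w
  have : w - v = (y - v) + (w - y) := by abel
  rw [this, norm_add_sq_real]
  exact le_of_eq (by ring)

lemma IsRegularizer.prox_lipschitz (hR : IsRegularizer R) {η : ℝ} (hη : 0 < η) (u v : E) :
    ‖prox η R u - prox η R v‖ ≤ ‖u - v‖ := by
  have h1 := hR.prox_variational hη u (hR.prox_mem hη v)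
  have h2 := hR.prox_variational hη v (hR.prox_mem hη u)
  set p := prox η R u
  set q := prox η R v
  have h3 : inner ℝ (p - u) (q - p) + inner ℝ (q - v) (p - q)
      = inner ℝ (u - v) (p - q) - ‖p - q‖ ^ 2 := by
    rw [← real_inner_self_eq_norm_sq, ← neg_sub p q, inner_neg_right, neg_add_eq_sub,
      ← inner_sub_left, ← inner_sub_left]
    congr 1
    abel
  have h4 := real_inner_le_norm (u - v) (p - q)
  by_contra! hlt
  nlinarith [norm_nonneg (u - v), norm_nonneg (p - q)]

lemma IsRegularizer.continuous_prox (hR : IsRegularizer R) {η : ℝ} (hη : 0 < η) :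
    Continuous (prox η R) :=
  (LipschitzWith.of_dist_le_mul (K := 1) fun u v => by
    simpa [dist_eq_norm] using hR.prox_lipschitz hη u v).continuous

/-- One proximal gradient step with an inexact direction `v`, compared with a point `y` of the
domain. -/
lemma IsRegularizer.prox_step [CompleteSpace E] (hR : IsRegularizer R) {η : ℝ} (hη : 0 < η)
    {F : E → ℝ} (hF : Differentiable ℝ F) (hc : ConvexOn ℝ Set.univ F) {L : ℝ≥0}
    (hL : LipschitzWith L (gradient F)) (hηL : η * L ≤ 1) (x v : E) {y : E}
    (hy : y ∈ effDom R) :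
    ‖prox η R (x - η • v) - y‖ ^ 2
        + 2 * η * (F (prox η R (x - η • v)) + (R (prox η R (x - η • v))).toReal
            - (F y + (R y).toReal))
      ≤ ‖x - y‖ ^ 2 - 2 * η * inner ℝ (v - gradient F x) (prox η R (x - η • v) - y) := by
  have h1 := hR.prox_variational hη (x - η • v) hy
  set p := prox η R (x - η • v)
  have h2 := le_of_convexOn_gradient hF hc x y
  have h3 := le_quadratic_of_lipschitz_gradient hF hL x p
  have h4 : η * F p ≤ η * (F y - inner ℝ (gradient F x) (y - x)
      + inner ℝ (gradient F x) (p - x) + L / 2 * ‖p - x‖ ^ 2) := by gcongr; linarith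
  have h5 : η * L * ‖p - x‖ ^ 2 ≤ 1 * ‖p - x‖ ^ 2 := by gcongr
  have e1 : inner ℝ (p - (x - η • v)) (y - p) = inner ℝ (p - x) (y - p) + η * inner ℝ v (y - p) := by
    have : p - (x - η • v) = (p - x) + η • v := by abel
    rw [this, inner_add_left, real_inner_smul_left]
  have e2 : ‖x - y‖ ^ 2 = ‖p - x‖ ^ 2 + 2 * inner ℝ (p - x) (y - p) + ‖p - y‖ ^ 2 := by
    have : x - y = -((p - x) + (y - p)) := by abel
    rw [this, norm_neg, norm_add_sq_real, norm_sub_rev y p]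
  have e3 : inner ℝ (v - gradient F x) (p - y)
      = -inner ℝ v (y - p) + inner ℝ (gradient F x) (y - x) - inner ℝ (gradient F x) (p - x) := by
    have : y - p = -(p - y) := by abel
    rw [inner_sub_left, this, inner_neg_right, neg_neg, add_sub_assoc, ← inner_sub_right]
    have : y - x - (p - x) = -(p - y) := by abel
    rw [this, inner_neg_right]; ring
  rw [e1] at h1
  rw [e2, e3]
  nlinarith

end Regularizer

/-! ### The error of the dithered quantizer -/

section Quantizer

lemma ditherQuant_sub (zbar Δ ν z : ℝ) :
    ditherQuant zbar Δ ν z - z = Real.sign (z + ν - zbar) * Δ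
      * (⌊|z + ν - zbar| / Δ + 1 / 2⌋ : ℝ) - (z + ν - zbar) := by
  unfold ditherQuant uniformQuant
  ring

/-- Away from the ties of the rounding, the quantization error is a sawtooth function. -/
lemma sign_mul_floor_sub {Δ : ℝ} (hΔ : 0 < Δ) {w : ℝ} (hw : Int.fract (w / Δ + 1 / 2) ≠ 0) :
    Real.sign w * Δ * (⌊|w| / Δ + 1 / 2⌋ : ℝ) - w
      = Δ * (1 / 2 - Int.fract (w / Δ + 1 / 2)) := by
  have hfl : ∀ y : ℝ, (⌊y⌋ : ℝ) = y - Int.fract y := fun y => by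
    have := Int.floor_add_fract y
    linarith
  rcases lt_trichotomy w 0 with h | h | h
  · have e : |w| / Δ + 1 / 2 = -(w / Δ + 1 / 2) + (1 : ℤ) := by
      rw [abs_of_neg h]; push_cast; ring
    rw [Real.sign_of_neg h, hfl, e, Int.fract_add_intCast, Int.fract_neg hw]
    field_simp
    push_cast
    ring
  · subst h
    norm_num
  · rw [Real.sign_of_pos h, hfl, abs_of_pos h]
    field_simp
    ring

lemma abs_ditherQuant_sub_le {Δ : ℝ} (hΔ : 0 < Δ) (zbar ν z : ℝ) :
    |ditherQuant zbar Δ ν z - z| ≤ Δ / 2 := by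
  rw [ditherQuant_sub]
  set w := z + ν - zbar
  have key : ∀ y : ℝ, 0 < y → |Δ * (⌊y / Δ + 1 / 2⌋ : ℝ) - y| ≤ Δ / 2 := by
    intro y _
    have h1 := Int.floor_le (y / Δ + 1 / 2)
    have h2 := Int.lt_floor_add_one (y / Δ + 1 / 2)
    have h3 : Δ * (y / Δ) = y := by field_simp
    rw [abs_le]
    constructor <;> nlinarith
  rcases lt_trichotomy w 0 with h | h | h
  · rw [Real.sign_of_neg h, abs_of_neg h]
    have := key (-w) (by linarith)
    rw [← abs_neg]
    convert this using 2
    ring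
  · rw [h]
    simpa using (half_pos hΔ).le
  · rw [Real.sign_of_pos h, abs_of_pos h, one_mul]
    exact key w h

lemma measurable_ditherQuant {α : Type*} [MeasurableSpace α] {zbar ν z : α → ℝ} (Δ : ℝ)
    (hzbar : Measurable zbar) (hν : Measurable ν) (hz : Measurable z) :
    Measurable fun a => ditherQuant (zbar a) Δ (ν a) (z a) := by
  have hsign : Measurable Real.sign := by
    unfold Real.sign
    exact Measurable.ite measurableSet_Iio measurable_const
      (Measurable.ite measurableSet_Ioi measurable_const measurable_const)
  have hw : Measurable fun a => z a + ν a - zbar a := by fun_prop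
  have hfl : Measurable fun a => ((⌊|z a + ν a - zbar a| / Δ + 1 / 2⌋ : ℤ) : ℝ) :=
    (measurable_of_countable (fun n : ℤ => (n : ℝ))).comp
      (Int.measurable_floor.comp ((hw.abs.div_const Δ).add_const _))
  unfold ditherQuant uniformQuant
  exact (hzbar.add (((hsign.comp hw).mul_const Δ).mul hfl)).sub hν

/-- Averages over one period of a function of the sawtooth. -/
lemma intervalIntegral_fract {Δ : ℝ} (hΔ : 0 < Δ) (φ : ℝ → ℝ) (c : ℝ) :
    ∫ u in (-Δ / 2)..(Δ / 2), φ (Int.fract (u / Δ + c)) = Δ * ∫ y in (0 : ℝ)..1, φ y := by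
  have hper : Function.Periodic (fun y : ℝ => φ (Int.fract y)) 1 := by
    intro y
    simp
  rw [intervalIntegral.integral_comp_div_add (fun y => φ (Int.fract y)) hΔ.ne' c, smul_eq_mul]
  congr 1
  have e : Δ / 2 / Δ + c = (-Δ / 2 / Δ + c) + 1 := by field_simp; ring
  rw [e, hper.intervalIntegral_add_eq _ 0, zero_add]
  refine intervalIntegral.integral_congr_ae ?_
  filter_upwards [Measure.ae_ne volume (1 : ℝ)] with y hy hmem
  rw [Set.uIoc_of_le zero_le_one] at hmem
  rw [Int.fract_eq_self.2 ⟨hmem.1.le, lt_of_le_of_ne hmem.2 hy⟩]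

/-- The expectation over a uniform dither of a function of the quantization error; the error is
uniform on an interval of length `Δ`, whatever the value and the midpoint. -/
lemma integral_uniform_ditherQuant {Δ : ℝ} (hΔ : 0 < Δ) (φ : ℝ → ℝ) (zbar z : ℝ) :
    ∫ u, φ (ditherQuant zbar Δ u z - z) ∂(volume[|Set.Ioo (-Δ / 2) (Δ / 2)])
      = ∫ y in (0 : ℝ)..1, φ (Δ * (1 / 2 - y)) := by
  have hvol : volume (Set.Ioo (-Δ / 2) (Δ / 2)) = ENNReal.ofReal Δ := by
    rw [Real.volume_Ioo]; congr 1; ring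
  -- the ties form a countable set
  have hne : ∀ᵐ u : ℝ, Int.fract (u / Δ + ((z - zbar) / Δ + 1 / 2)) ≠ 0 := by
    have hc : (Set.range fun n : ℤ => Δ * (n - ((z - zbar) / Δ + 1 / 2))).Countable :=
      Set.countable_range _
    filter_upwards [hc.ae_notMem volume] with u hu h0
    refine hu ⟨⌊u / Δ + ((z - zbar) / Δ + 1 / 2)⌋, ?_⟩
    have := Int.floor_add_fract (u / Δ + ((z - zbar) / Δ + 1 / 2))
    rw [h0, add_zero] at this
    simp only [this]
    field_simp
    ring
  have hab : -Δ / 2 ≤ Δ / 2 := by linarith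
  rw [ProbabilityTheory.cond, integral_smul_measure, hvol, ← integral_Ioc_eq_integral_Ioo,
    ← intervalIntegral.integral_of_le hab]
  have h1 : ∫ u in (-Δ / 2)..(Δ / 2), φ (ditherQuant zbar Δ u z - z)
      = ∫ u in (-Δ / 2)..(Δ / 2),
        φ (Δ * (1 / 2 - Int.fract (u / Δ + ((z - zbar) / Δ + 1 / 2)))) := by
    refine intervalIntegral.integral_congr_ae ?_
    filter_upwards [hne] with u hu _
    have e : (z + u - zbar) / Δ + 1 / 2 = u / Δ + ((z - zbar) / Δ + 1 / 2) := by ring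
    rw [ditherQuant_sub, sign_mul_floor_sub hΔ (by rwa [e]), e]
  rw [h1, intervalIntegral_fract hΔ (fun y => φ (Δ * (1 / 2 - y))), ENNReal.toReal_inv,
    ENNReal.toReal_ofReal hΔ.le, smul_eq_mul]
  field_simp

lemma integral_uniform_ditherQuant_sub {Δ : ℝ} (hΔ : 0 < Δ) (zbar z : ℝ) :
    ∫ u, (ditherQuant zbar Δ u z - z) ∂(volume[|Set.Ioo (-Δ / 2) (Δ / 2)]) = 0 := by
  rw [integral_uniform_ditherQuant hΔ (fun x => x), intervalIntegral.integral_const_mul,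
    intervalIntegral.integral_sub (by simp) (by simp), integral_id]
  norm_num

lemma integral_uniform_ditherQuant_sub_sq {Δ : ℝ} (hΔ : 0 < Δ) (zbar z : ℝ) :
    ∫ u, (ditherQuant zbar Δ u z - z) ^ 2 ∂(volume[|Set.Ioo (-Δ / 2) (Δ / 2)])
      = Δ ^ 2 / 12 := by
  rw [integral_uniform_ditherQuant hΔ (fun x => x ^ 2)]
  have h : ∀ y : ℝ, (Δ * (1 / 2 - y)) ^ 2 = Δ ^ 2 * ((fun x => x ^ 2) (1 / 2 - y)) := by
    intro y; ring
  simp only [h]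
  rw [intervalIntegral.integral_const_mul,
    intervalIntegral.integral_comp_sub_left (fun x : ℝ => x ^ 2) (1 / 2), integral_pow]
  norm_num
  ring

end Quantizer

/-! ### Integrating out one of several independent variables -/

section Independence

variable {Ω : Type*} [MeasurableSpace Ω] {P : Measure Ω}

/-- If `X` is independent of `Y`, and `(X, Y)` is independent of `Z`, then `X` is independent of
`(Y, Z)`. -/
lemma IndepFun.prodMk_of_prodMk {α β γ : Type*} [MeasurableSpace α] [MeasurableSpace β]
    [MeasurableSpace γ] [IsProbabilityMeasure P] {X : Ω → α} {Y : Ω → β} {Z : Ω → γ}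
    (hX : Measurable X) (hY : Measurable Y) (hZ : Measurable Z) (hXY : IndepFun X Y P)
    (hXYZ : IndepFun (fun ω => (X ω, Y ω)) Z P) : IndepFun X (fun ω => (Y ω, Z ω)) P := by
  have : IsProbabilityMeasure (P.map X) := Measure.isProbabilityMeasure_map hX.aemeasurable
  have : IsProbabilityMeasure (P.map Y) := Measure.isProbabilityMeasure_map hY.aemeasurable
  have : IsProbabilityMeasure (P.map Z) := Measure.isProbabilityMeasure_map hZ.aemeasurable
  have hYZ : IndepFun Y Z P := hXYZ.comp measurable_snd measurable_id
  rw [indepFun_iff_map_prod_eq_prod_map_map hX.aemeasurable (hY.prodMk hZ).aemeasurable,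
    (indepFun_iff_map_prod_eq_prod_map_map hY.aemeasurable hZ.aemeasurable).1 hYZ,
    ← Measure.prodAssoc_prod,
    ← (indepFun_iff_map_prod_eq_prod_map_map hX.aemeasurable hY.aemeasurable).1 hXY,
    ← (indepFun_iff_map_prod_eq_prod_map_map (hX.prodMk hY).aemeasurable hZ.aemeasurable).1 hXYZ,
    Measure.map_map MeasurableEquiv.prodAssoc.measurable ((hX.prodMk hY).prodMk hZ)]
  rfl

/-- A member of an independent family is independent of the family without it. -/
lemma iIndepFun.indepFun_update {ι β : Type*} [DecidableEq ι] [MeasurableSpace β] {X : ι → Ω → β}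
    (hX : ∀ i, Measurable (X i)) (h : iIndepFun X P) (i : ι) (c : β) :
    IndepFun (X i) (fun ω => Function.update (fun j => X j ω) i c) P := by
  have hdis := indep_iSup_of_disjoint (fun j => (hX j).comap_le) h
    (disjoint_compl_right (a := ({i} : Set ι)))
  refine indep_of_indep_of_le_left (indep_of_indep_of_le_right hdis ?_) ?_
  · rw [← measurable_iff_comap_le]
    refine (@measurable_pi_iff _ _ _ (_) _ _).2 fun j => ?_
    by_cases hj : j = i
    · subst hj
      simp only [Function.update_self]
      exact measurable_const
    · simp only [Function.update_of_ne hj]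
      rw [measurable_iff_comap_le]
      exact le_iSup₂_of_le j (by simpa using hj) le_rfl
  · exact le_iSup₂_of_le (f := fun j (_ : j ∈ ({i} : Set ι)) => MeasurableSpace.comap (X j) _)
      i (by simp) le_rfl

/-- The expectation of a function of two independent variables, with the first one integrated out
first. -/
lemma IndepFun.integral_fubini {α β : Type*} [MeasurableSpace α] [MeasurableSpace β]
    [IsProbabilityMeasure P] {X : Ω → α} {Y : Ω → β} (hX : Measurable X) (hY : Measurable Y)
    (hXY : IndepFun X Y P) {f : α → β → ℝ} (hf : Measurable (Function.uncurry f)) {C : ℝ}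
    (hC : ∀ a b, |f a b| ≤ C) :
    ∫ ω, f (X ω) (Y ω) ∂P = ∫ ω, (∫ a, f a (Y ω) ∂(P.map X)) ∂P := by
  have : IsProbabilityMeasure (P.map X) := Measure.isProbabilityMeasure_map hX.aemeasurable
  have : IsProbabilityMeasure (P.map Y) := Measure.isProbabilityMeasure_map hY.aemeasurable
  have h1 : ∫ ω, f (X ω) (Y ω) ∂P
      = ∫ z, Function.uncurry f z ∂(P.map fun ω => (X ω, Y ω)) := by
    rw [integral_map (hX.prodMk hY).aemeasurable hf.aestronglyMeasurable]
    rfl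
  rw [h1, (indepFun_iff_map_prod_eq_prod_map_map hX.aemeasurable hY.aemeasurable).1 hXY,
    integral_prod_symm _ (Integrable.of_bound hf.aestronglyMeasurable C
      (Filter.Eventually.of_forall fun z => hC z.1 z.2)),
    integral_map hY.aemeasurable]
  · rfl
  · exact (hf.stronglyMeasurable.integral_prod_left (μ := P.map X)).aestronglyMeasurable

end Independence

/-! ### Bounded measurable functions -/

section BddMeas

variable {α : Type*} [MeasurableSpace α]

/-- `f` is measurable and bounded everywhere. This class contains all iterates and errors of the
algorithm, is closed under composition with continuous maps, and consists of integrable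
functions. -/
def BddMeas {E : Type*} [NormedAddCommGroup E] [MeasurableSpace E] (f : α → E) : Prop :=
  Measurable f ∧ ∃ C : ℝ, ∀ a, ‖f a‖ ≤ C

namespace BddMeas

variable {E F : Type*} [NormedAddCommGroup E] [MeasurableSpace E] [BorelSpace E]
  [ProperSpace E] [SecondCountableTopology E] [NormedAddCommGroup F] [MeasurableSpace F]
  [BorelSpace F] [SecondCountableTopology F]

omit [BorelSpace E] [ProperSpace E] [SecondCountableTopology E] in
lemma const (c : E) : BddMeas (fun _ : α => c) := ⟨measurable_const, ‖c‖, fun _ => le_rfl⟩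

omit [SecondCountableTopology E] [SecondCountableTopology F] in
lemma comp {f : α → E} (hf : BddMeas f) {g : E → F} (hg : Continuous g) :
    BddMeas (fun a => g (f a)) := by
  obtain ⟨C, hC⟩ := hf.2
  obtain ⟨C', hC'⟩ := (isCompact_closedBall (0 : E) C).exists_bound_of_continuousOn
    hg.continuousOn
  exact ⟨hg.measurable.comp hf.1, C', fun a => hC' _ (by simpa using hC a)⟩

omit [BorelSpace E] [ProperSpace E] [SecondCountableTopology E] [BorelSpace F]
  [SecondCountableTopology F] in
lemma prodMk {f : α → E} {g : α → F} (hf : BddMeas f) (hg : BddMeas g) :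
    BddMeas (fun a => (f a, g a)) := by
  obtain ⟨C, hC⟩ := hf.2
  obtain ⟨C', hC'⟩ := hg.2
  exact ⟨hf.1.prodMk hg.1, max C C', fun a => max_le_max (hC a) (hC' a)⟩

omit [SecondCountableTopology E] in
lemma comp₂ {G : Type*} [NormedAddCommGroup G] [MeasurableSpace G] [BorelSpace G] [ProperSpace F]
    {f : α → E} {g : α → F} (hf : BddMeas f) (hg : BddMeas g) {h : E → F → G}
    (hh : Continuous (Function.uncurry h)) : BddMeas (fun a => h (f a) (g a)) :=
  (hf.prodMk hg).comp hh

lemma add {f g : α → E} (hf : BddMeas f) (hg : BddMeas g) : BddMeas (fun a => f a + g a) :=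
  hf.comp₂ hg continuous_add

lemma sub {f g : α → E} (hf : BddMeas f) (hg : BddMeas g) : BddMeas (fun a => f a - g a) :=
  hf.comp₂ hg continuous_sub

lemma sum {ι : Type*} (s : Finset ι) {f : ι → α → E} (hf : ∀ i ∈ s, BddMeas (f i)) :
    BddMeas (fun a => ∑ i ∈ s, f i a) := by
  classical
  induction s using Finset.induction_on with
  | empty => simpa using const (0 : E)
  | insert i s hi ih =>
    simp only [Finset.sum_insert hi]
    exact (hf i (by simp)).add (ih fun j hj => hf j (by simp [hj]))

lemma inner [InnerProductSpace ℝ E] {f g : α → E} (hf : BddMeas f) (hg : BddMeas g) :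
    BddMeas (fun a => inner ℝ (f a) (g a)) :=
  hf.comp₂ hg continuous_inner

omit [SecondCountableTopology E] in
lemma norm_sq {f : α → E} (hf : BddMeas f) : BddMeas (fun a => ‖f a‖ ^ 2) :=
  hf.comp (continuous_norm.pow 2)

lemma mul {f g : α → ℝ} (hf : BddMeas f) (hg : BddMeas g) : BddMeas (fun a => f a * g a) :=
  hf.comp₂ hg continuous_mul

lemma const_mul {f : α → ℝ} (hf : BddMeas f) (c : ℝ) : BddMeas (fun a => c * f a) :=
  (const c).mul hf

lemma integrable {f : α → ℝ} (hf : BddMeas f) (μ : Measure α) [IsFiniteMeasure μ] :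
    Integrable f μ := by
  obtain ⟨C, hC⟩ := hf.2
  exact Integrable.of_bound hf.1.aestronglyMeasurable C (Filter.Eventually.of_forall hC)

omit [BorelSpace E] [ProperSpace E] [SecondCountableTopology E] in
/-- A finite family of bounded measurable functions, evaluated at a random member. -/
lemma select {ι : Type*} [Finite ι] [MeasurableSpace ι] [MeasurableSingletonClass ι]
    {f : ι → α → E} (hf : ∀ i, BddMeas (f i)) {l : α → ι} (hl : Measurable l) :
    BddMeas (fun a => f (l a) a) := by
  choose C hC using fun i => (hf i).2
  cases nonempty_fintype ι
  refine ⟨?_, ∑ i, |C i|, fun a => ((hC (l a) a).trans (le_abs_self _)).trans ?_⟩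
  · have h : Measurable (fun z : ι × α => f z.1 z.2) :=
      measurable_from_prod_countable_right fun i => (hf i).1
    exact h.comp (hl.prodMk measurable_id)
  · exact Finset.single_le_sum (f := fun i => |C i|) (fun i _ => abs_nonneg _) (Finset.mem_univ _)

/-- Vectors with bounded measurable blocks. -/
lemma toLp {ι : Type*} [Fintype ι] {G : ι → Type*} [∀ i, NormedAddCommGroup (G i)]
    [∀ i, NormedSpace ℝ (G i)] [∀ i, MeasurableSpace (G i)] [∀ i, BorelSpace (G i)]
    [∀ i, SecondCountableTopology (G i)] [∀ i, ProperSpace (G i)] {f : ∀ i, α → G i}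
    (hf : ∀ i, BddMeas (f i)) :
    BddMeas (fun a => (WithLp.toLp 2 fun i => f i a : PiLp 2 G)) := by
  choose C hC using fun i => (hf i).2
  have h : BddMeas (fun a => (fun i => f i a : ∀ i, G i)) := by
    refine ⟨measurable_pi_lambda _ fun i => (hf i).1, ∑ i, |C i|, fun a => ?_⟩
    refine (pi_norm_le_iff_of_nonneg (Finset.sum_nonneg fun i _ => abs_nonneg _)).2 fun i => ?_
    refine ((hC i a).trans (le_abs_self _)).trans ?_
    exact Finset.single_le_sum (f := fun i => |C i|) (fun i _ => abs_nonneg _) (Finset.mem_univ _)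
  exact h.comp (PiLp.continuous_toLp 2 G)

end BddMeas

end BddMeas

/-! ### The law of the random inputs -/

section Law

variable {N : ℕ}

/-- Realizations of all dithers and of all chosen nodes. -/
abbrev Inputs (m : Fin N → ℕ) : Type := (DitherIndex m → ℝ) × (ℕ → ℕ → Fin N)

/-- The value of `f` does not depend on the dither `q`. -/
def IgnoresDither {m : Fin N → ℕ} {β : Type*} (q : DitherIndex m) (f : Inputs m → β) : Prop :=
  ∀ ν ν' ell, (∀ q' ≠ q, ν q' = ν' q') → f (ν, ell) = f (ν', ell)

/-- The value of `f` does not depend on the node chosen in inner iteration `t` of outer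
iteration `s`. -/
def IgnoresNode {m : Fin N → ℕ} {β : Type*} (s t : ℕ) (f : Inputs m → β) : Prop :=
  ∀ ν ell ell', (∀ a b, (a, b) ≠ (s, t) → ell a b = ell' a b) → f (ν, ell) = f (ν, ell')

section Ignores

variable {m : Fin N → ℕ} {β γ δ : Type*} {q : DitherIndex m} {s t : ℕ}

lemma IgnoresDither.comp {f : Inputs m → β} (hf : IgnoresDither q f) (g : β → γ) :
    IgnoresDither q (fun θ => g (f θ)) :=
  fun ν ν' ell h => congrArg g (hf ν ν' ell h)

lemma IgnoresDither.comp₂ {f : Inputs m → β} {f' : Inputs m → γ} (hf : IgnoresDither q f)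
    (hf' : IgnoresDither q f') (g : β → γ → δ) : IgnoresDither q (fun θ => g (f θ) (f' θ)) :=
  fun ν ν' ell h => congrArg₂ g (hf ν ν' ell h) (hf' ν ν' ell h)

lemma IgnoresNode.comp {f : Inputs m → β} (hf : IgnoresNode s t f) (g : β → γ) :
    IgnoresNode s t (fun θ => g (f θ)) :=
  fun ν ell ell' h => congrArg g (hf ν ell ell' h)

lemma IgnoresNode.comp₂ {f : Inputs m → β} {f' : Inputs m → γ} (hf : IgnoresNode s t f)
    (hf' : IgnoresNode s t f') (g : β → γ → δ) : IgnoresNode s t (fun θ => g (f θ) (f' θ)) :=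
  fun ν ell ell' h => congrArg₂ g (hf ν ell ell' h) (hf' ν ell ell' h)

end Ignores

/-- What the analysis uses of the joint law of the inputs: a single dither, or a single chosen
node, can be integrated out first, against its uniform distribution. -/
structure IsInputLaw (S : Setup N) (Q : Measure (Inputs S.m)) : Prop where
  isProbabilityMeasure : IsProbabilityMeasure Q
  integral_dither : ∀ (q : DitherIndex S.m) (f : ℝ → Inputs S.m → ℝ) (C : ℝ),
    Measurable (Function.uncurry f) → (∀ u θ, |f u θ| ≤ C) → (∀ u, IgnoresDither q (f u)) →
    ∫ θ, f (θ.1 q) θ ∂Q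
      = ∫ θ, (∫ u, f u θ ∂(volume[|Set.Ioo (-(S.ditherStep q) / 2) (S.ditherStep q / 2)])) ∂Q
  integral_node : ∀ (s t : ℕ) (f : Fin N → Inputs S.m → ℝ),
    (∀ l, BddMeas (f l)) → (∀ l, IgnoresNode s t (f l)) →
    ∫ θ, f (θ.2 s t) θ ∂Q = 1 / N * ∑ l, ∫ θ, f l θ ∂Q

/-- The random element of `Inputs` that the random variables of the algorithm form. -/
def inputs {m : Fin N → ℕ} {Ω : Type*} (ν : DitherIndex m → Ω → ℝ) (ell : ℕ → ℕ → Ω → Fin N)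
    (ω : Ω) : Inputs m :=
  (fun q => ν q ω, fun a b => ell a b ω)

variable {S : Setup N} {Ω : Type*} [MeasurableSpace Ω] {P : Measure Ω}
  {ν : DitherIndex S.m → Ω → ℝ} {ell : ℕ → ℕ → Ω → Fin N}

lemma measurable_inputs (h : S.IsRandomInput P ν ell) : Measurable (inputs ν ell) :=
  (measurable_pi_lambda _ h.measurable_dither).prodMk
    (measurable_pi_lambda _ fun s => measurable_pi_lambda _ fun t => h.measurable_node s t)

lemma isInputLaw_map [IsProbabilityMeasure P] (h : S.IsRandomInput P ν ell) :
    IsInputLaw S (P.map (inputs ν ell)) := by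
  classical
  have hΞ := measurable_inputs h
  have hν : Measurable fun ω q => ν q ω := measurable_pi_lambda _ h.measurable_dither
  have hell : Measurable fun ω (q : ℕ × ℕ) => ell q.1 q.2 ω :=
    measurable_pi_lambda _ fun q => h.measurable_node q.1 q.2
  have huncurry : Measurable fun (e : ℕ × ℕ → Fin N) (a b : ℕ) => e (a, b) :=
    measurable_pi_lambda _ fun a => measurable_pi_lambda _ fun b => measurable_pi_apply (a, b)
  refine ⟨Measure.isProbabilityMeasure_map hΞ.aemeasurable, ?_, ?_⟩
  · intro q f C hf hC hig
    have hY : Measurable fun ω => Function.update (fun q => ν q ω) q 0 := by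
      refine measurable_pi_lambda _ fun q' => ?_
      by_cases hq : q' = q
      · subst hq; simp
      · simpa only [Function.update_of_ne hq] using h.measurable_dither q'
    have hind : IndepFun (ν q) (fun ω => (Function.update (fun q => ν q ω) q 0,
        fun q : ℕ × ℕ => ell q.1 q.2 ω)) P := by
      refine IndepFun.prodMk_of_prodMk (h.measurable_dither q) hY hell
        (iIndepFun.indepFun_update h.measurable_dither h.indep_dither q 0) ?_
      have hpair : Measurable fun v : DitherIndex S.m → ℝ => (v q, Function.update v q 0) := by
        refine (measurable_pi_apply q).prodMk (measurable_pi_lambda _ fun q' => ?_)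
        by_cases hq : q' = q
        · subst hq; simp
        · simpa only [Function.update_of_ne hq] using measurable_pi_apply q'
      exact h.indep_dither_node.comp hpair measurable_id
    have hind' : IndepFun (ν q) (fun ω => ((Function.update (fun q => ν q ω) q 0,
        fun a b => ell a b ω) : Inputs S.m)) P :=
      hind.comp measurable_id (measurable_fst.prodMk (huncurry.comp measurable_snd))
    have key : ∀ u ω, f u (inputs ν ell ω)
        = f u (Function.update (fun q => ν q ω) q 0, fun a b => ell a b ω) := fun u ω =>
      hig u _ _ _ fun q' hq' => (Function.update_of_ne hq' 0 fun q => ν q ω).symm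
    have hlaw : P.map (ν q)
        = volume[|Set.Ioo (-(S.ditherStep q) / 2) (S.ditherStep q / 2)] := h.uniform_dither q
    have hfub := IndepFun.integral_fubini (h.measurable_dither q)
      (hY.prodMk (huncurry.comp hell)) hind' hf hC
    rw [hlaw] at hfub
    rw [integral_map hΞ.aemeasurable, integral_map hΞ.aemeasurable]
    · simp only [key]
      exact hfub
    · exact hf.stronglyMeasurable.integral_prod_left.aestronglyMeasurable
    · have hm : Measurable fun θ : Inputs S.m => (θ.1 q, θ) :=
        ((measurable_pi_apply q).comp measurable_fst).prodMk measurable_id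
      exact (hf.comp hm).aestronglyMeasurable
  · intro s t f hf hig
    rcases isEmpty_or_nonempty (Fin N) with hN | ⟨⟨l₀⟩⟩
    · have : IsEmpty Ω := ⟨fun ω => hN.elim (ell 0 0 ω)⟩
      simp [Measure.eq_zero_of_isEmpty P]
    have hX := h.measurable_node s t
    have hupd : Measurable fun e : ℕ × ℕ → Fin N => Function.update e (s, t) l₀ := by
      refine measurable_pi_lambda _ fun q' => ?_
      by_cases hq : q' = (s, t)
      · subst hq; simp
      · simpa only [Function.update_of_ne hq] using measurable_pi_apply q'
    have hind : IndepFun (ell s t) (fun ω => (Function.update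
        (fun q : ℕ × ℕ => ell q.1 q.2 ω) (s, t) l₀, fun q => ν q ω)) P := by
      refine IndepFun.prodMk_of_prodMk hX (hupd.comp hell) hν
        (iIndepFun.indepFun_update (fun q : ℕ × ℕ => h.measurable_node q.1 q.2) h.indep_node
          (s, t) l₀) ?_
      exact h.indep_dither_node.symm.comp ((measurable_pi_apply (s, t)).prodMk hupd) measurable_id
    have hind' : IndepFun (ell s t) (fun ω => ((fun q => ν q ω, fun a b => Function.update
        (fun q : ℕ × ℕ => ell q.1 q.2 ω) (s, t) l₀ (a, b)) : Inputs S.m)) P :=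
      hind.comp measurable_id (measurable_snd.prodMk (huncurry.comp measurable_fst))
    have key : ∀ l ω, f l (inputs ν ell ω) = f l (fun q => ν q ω, fun a b => Function.update
        (fun q : ℕ × ℕ => ell q.1 q.2 ω) (s, t) l₀ (a, b)) := fun l ω =>
      hig l _ _ _ fun a b hab => (Function.update_of_ne hab l₀ fun q : ℕ × ℕ => ell q.1 q.2 ω).symm
    choose C hC using fun l => (hf l).2
    have hfm : Measurable (Function.uncurry f) :=
      measurable_from_prod_countable_right fun l => (hf l).1
    have hfub := IndepFun.integral_fubini hX (hν.prodMk (huncurry.comp (hupd.comp hell))) hind'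
      hfm (C := ∑ l, |C l|) (fun l θ => ((hC l θ).trans (le_abs_self _)).trans
        (Finset.single_le_sum (f := fun l => |C l|) (fun _ _ => abs_nonneg _)
          (Finset.mem_univ l)))
    have : IsProbabilityMeasure (P.map (ell s t)) :=
      Measure.isProbabilityMeasure_map hX.aemeasurable
    have hreal : ∀ l, (P.map (ell s t)).real {l} = 1 / N := fun l => by
      rw [map_measureReal_apply hX (measurableSet_singleton l), Measure.real]
      have := h.uniform_node s t l
      simp only [Set.preimage, Set.mem_singleton_iff, this]
      simp
    rw [integral_map hΞ.aemeasurable]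
    · simp_rw [integral_map hΞ.aemeasurable (hf _).1.aestronglyMeasurable]
      have hΞint : ∀ l, Integrable (fun ω => f l (inputs ν ell ω)) P := fun l =>
        Integrable.of_bound ((hf l).1.comp hΞ).aestronglyMeasurable (C l)
          (Filter.Eventually.of_forall fun ω => hC l _)
      rw [← integral_finsetSum _ fun l _ => hΞint l, ← integral_const_mul]
      simp only [key] at hΞint ⊢
      refine hfub.trans (integral_congr_ae (Filter.Eventually.of_forall fun ω => ?_))
      change ∫ a, f a _ ∂(P.map (ell s t)) = _
      rw [integral_fintype (Integrable.of_finite)]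
      simp only [hreal, smul_eq_mul, Finset.mul_sum]
      rfl
    · have hm : Measurable fun θ : Inputs S.m => (θ.2 s t, θ) :=
        (measurable_pi_iff.1 (measurable_pi_iff.1 measurable_snd s) t).prodMk measurable_id
      exact (hfm.comp hm).aestronglyMeasurable

end Law

lemma integral_norm_add_sq {α V : Type*} [MeasurableSpace α] (Q : Measure α) [IsFiniteMeasure Q]
    [NormedAddCommGroup V] [InnerProductSpace ℝ V] [MeasurableSpace V] [BorelSpace V]
    [ProperSpace V] [SecondCountableTopology V] {a b : α → V} (ha : BddMeas a) (hb : BddMeas b) :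
    ∫ θ, ‖a θ + b θ‖ ^ 2 ∂Q
      = ∫ θ, ‖a θ‖ ^ 2 ∂Q + 2 * ∫ θ, inner ℝ (a θ) (b θ) ∂Q + ∫ θ, ‖b θ‖ ^ 2 ∂Q := by
  have i1 := ha.norm_sq.integrable Q
  have i2 := hb.norm_sq.integrable Q
  have i3 := ((ha.inner hb).integrable Q).const_mul 2
  have i4 : Integrable (fun θ => ‖a θ‖ ^ 2 + 2 * inner ℝ (a θ) (b θ)) Q := i1.add i3
  simp only [norm_add_sq_real]
  rw [integral_add i4 i2, integral_add i1 i3, integral_const_mul]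

/-! ### Dither errors -/

section DitherError

variable {N : ℕ} {S : Setup N} {Q : Measure (Inputs S.m)}

/-- `e` is the error of a scalar dithered quantization with dither `q`, where the quantized value
and the midpoint do not depend on `q`. -/
structure IsDitherErr (S : Setup N) (q : DitherIndex S.m) (e : Inputs S.m → ℝ) : Prop where
  step_pos : 0 < S.ditherStep q
  eq : ∃ zbar z : Inputs S.m → ℝ, Measurable zbar ∧ Measurable z ∧ IgnoresDither q zbar ∧
    IgnoresDither q z ∧
    ∀ θ, e θ = ditherQuant (zbar θ) (S.ditherStep q) (θ.1 q) (z θ) - z θ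

variable {q : DitherIndex S.m} {e : Inputs S.m → ℝ}

lemma IsDitherErr.bddMeas (he : IsDitherErr S q e) : BddMeas e := by
  obtain ⟨hΔ, zbar, z, hzbar, hz, -, -, h⟩ := he
  obtain rfl : e = _ := funext h
  exact ⟨(measurable_ditherQuant _ hzbar ((measurable_pi_apply q).comp measurable_fst) hz).sub hz,
    _, fun θ => abs_ditherQuant_sub_le hΔ _ _ _⟩

lemma IsDitherErr.integral_mul (hQ : IsInputLaw S Q) (he : IsDitherErr S q e)
    {W : Inputs S.m → ℝ} (hW : BddMeas W) (hWq : IgnoresDither q W) :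
    ∫ θ, W θ * e θ ∂Q = 0 := by
  obtain ⟨hΔ, zbar, z, hzbar, hz, hzbarq, hzq, h⟩ := he
  obtain ⟨C, hC⟩ := hW.2
  have := hQ.integral_dither q
    (fun u θ => W θ * (ditherQuant (zbar θ) (S.ditherStep q) u (z θ) - z θ))
    (C * (S.ditherStep q / 2)) ?_ ?_ ?_
  · simp only [h, this, integral_const_mul, integral_uniform_ditherQuant_sub hΔ, mul_zero,
      integral_zero]
  · exact (hW.1.comp measurable_snd).mul ((measurable_ditherQuant _ (hzbar.comp measurable_snd)
      measurable_fst (hz.comp measurable_snd)).sub (hz.comp measurable_snd))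
  · intro u θ
    rw [abs_mul]
    exact mul_le_mul (hC θ) (abs_ditherQuant_sub_le hΔ _ _ _) (abs_nonneg _)
      ((norm_nonneg _).trans (hC θ))
  · intro u
    exact hWq.comp₂ (hzbarq.comp₂ hzq fun a b => ditherQuant a (S.ditherStep q) u b - b) (· * ·)

lemma IsDitherErr.integral_sq (hQ : IsInputLaw S Q) (he : IsDitherErr S q e) :
    ∫ θ, e θ ^ 2 ∂Q = S.ditherStep q ^ 2 / 12 := by
  obtain ⟨hΔ, zbar, z, hzbar, hz, hzbarq, hzq, h⟩ := he
  have := hQ.integral_dither q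
    (fun u θ => (ditherQuant (zbar θ) (S.ditherStep q) u (z θ) - z θ) ^ 2)
    ((S.ditherStep q / 2) ^ 2) ?_ ?_ ?_
  · have hprob := hQ.isProbabilityMeasure
    simp only [h, this, integral_uniform_ditherQuant_sub_sq hΔ]
    simp
  · exact ((measurable_ditherQuant _ (hzbar.comp measurable_snd)
      measurable_fst (hz.comp measurable_snd)).sub (hz.comp measurable_snd)).pow_const 2
  · intro u θ
    rw [abs_pow]
    exact pow_le_pow_left₀ (abs_nonneg _) (abs_ditherQuant_sub_le hΔ _ _ _) 2
  · intro u
    exact hzbarq.comp₂ hzq fun a b => (ditherQuant a (S.ditherStep q) u b - b) ^ 2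

variable {ι : Type*} [Fintype ι] {n : ι → ℕ}

/-- `e` is the error of a componentwise dithered quantization with step size `Δ`, where coordinate
`k` of block `i` uses the dither `q i k`. -/
def IsDitherVec (S : Setup N) (q : ∀ i, Fin (n i) → DitherIndex S.m) (Δ : ℝ)
    (e : Inputs S.m → PiLp 2 fun i => EuclideanSpace ℝ (Fin (n i))) : Prop :=
  ∀ i k, S.ditherStep (q i k) = Δ ∧ IsDitherErr S (q i k) fun θ => e θ i k

variable {qs : ∀ i, Fin (n i) → DitherIndex S.m} {Δ : ℝ}
  {ev : Inputs S.m → PiLp 2 fun i => EuclideanSpace ℝ (Fin (n i))}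

lemma IsDitherVec.bddMeas (he : IsDitherVec S qs Δ ev) : BddMeas ev :=
  BddMeas.toLp (f := fun i θ => ev θ i) fun i =>
    BddMeas.toLp (f := fun k θ => ev θ i k) fun k => (he i k).2.bddMeas

lemma IsDitherVec.integral_inner (hQ : IsInputLaw S Q) (he : IsDitherVec S qs Δ ev)
    {W : Inputs S.m → PiLp 2 fun i => EuclideanSpace ℝ (Fin (n i))} (hW : BddMeas W)
    (hWq : ∀ i k, IgnoresDither (qs i k) W) : ∫ θ, inner ℝ (W θ) (ev θ) ∂Q = 0 := by
  have := hQ.isProbabilityMeasure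
  have hWik : ∀ i k, BddMeas fun θ => W θ i k := fun i k =>
    hW.comp (g := fun w => w i k) (by fun_prop)
  have hexp : ∀ θ, inner ℝ (W θ) (ev θ) = ∑ i, ∑ k, W θ i k * ev θ i k := fun θ => by
    simp [PiLp.inner_apply, mul_comm]
  simp only [hexp]
  have hint : ∀ i k, Integrable (fun θ => W θ i k * ev θ i k) Q := fun i k =>
    ((hWik i k).mul (he i k).2.bddMeas).integrable Q
  rw [integral_finsetSum _ fun i _ => integrable_finsetSum _ fun k _ => hint i k]
  refine Finset.sum_eq_zero fun i _ => ?_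
  rw [integral_finsetSum _ fun k _ => hint i k]
  exact Finset.sum_eq_zero fun k _ => (he i k).2.integral_mul hQ (hWik i k)
    ((hWq i k).comp fun w => w i k)

lemma IsDitherVec.integral_norm_sq (hQ : IsInputLaw S Q) (he : IsDitherVec S qs Δ ev) :
    ∫ θ, ‖ev θ‖ ^ 2 ∂Q = (∑ i, n i : ℕ) * (Δ ^ 2 / 12) := by
  have := hQ.isProbabilityMeasure
  have hexp : ∀ θ, ‖ev θ‖ ^ 2 = ∑ i, ∑ k, ev θ i k ^ 2 := fun θ => by
    simp [PiLp.norm_sq_eq_of_L2]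
  simp only [hexp]
  have hint : ∀ i k, Integrable (fun θ => ev θ i k ^ 2) Q := fun i k =>
    ((he i k).2.bddMeas.comp (continuous_pow 2)).integrable Q
  rw [integral_finsetSum _ fun i _ => integrable_finsetSum _ fun k _ => hint i k]
  simp only [integral_finsetSum _ fun k _ => hint _ k]
  have : ∀ i k, ∫ θ, ev θ i k ^ 2 ∂Q = Δ ^ 2 / 12 := fun i k => by
    rw [(he i k).2.integral_sq hQ, (he i k).1]
  simp only [this, Finset.sum_const, Finset.card_univ, Fintype.card_fin, nsmul_eq_mul]
  rw [← Finset.sum_mul]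
  push_cast
  rfl

/-- The gradient noise `H e₁ + e₂` caused by quantizing first the state and then the gradient is
uncorrelated with everything that does not depend on the dithers of `e₁` and `e₂`. -/
lemma integral_inner_noise (hQ : IsInputLaw S Q)
    {V : Type*} [NormedAddCommGroup V] [InnerProductSpace ℝ V] [FiniteDimensional ℝ V]
    [MeasurableSpace V] [BorelSpace V] {qs' : ∀ i, Fin (n i) → DitherIndex S.m} {Δ' : ℝ}
    {ev' : Inputs S.m → PiLp 2 fun i => EuclideanSpace ℝ (Fin (n i))}
    (he : IsDitherVec S qs Δ ev) (he' : IsDitherVec S qs' Δ' ev')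
    (H : (PiLp 2 fun i => EuclideanSpace ℝ (Fin (n i)))
      →L[ℝ] PiLp 2 fun i => EuclideanSpace ℝ (Fin (n i)))
    (B : (PiLp 2 fun i => EuclideanSpace ℝ (Fin (n i))) →L[ℝ] V)
    {W : Inputs S.m → V} (hW : BddMeas W) (hWq : ∀ i k, IgnoresDither (qs i k) W)
    (hWq' : ∀ i k, IgnoresDither (qs' i k) W) :
    ∫ θ, inner ℝ (W θ) (B (H (ev θ) + ev' θ)) ∂Q = 0 := by
  have := hQ.isProbabilityMeasure
  have : ProperSpace V := FiniteDimensional.proper_real V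
  have : CompleteSpace V := FiniteDimensional.complete ℝ V
  let B' := ContinuousLinearMap.adjoint B
  let H' := ContinuousLinearMap.adjoint H
  have hexp : ∀ θ, inner ℝ (W θ) (B (H (ev θ) + ev' θ))
      = inner ℝ (H' (B' (W θ))) (ev θ) + inner ℝ (B' (W θ)) (ev' θ) := fun θ => by
    rw [map_add, inner_add_right, ContinuousLinearMap.adjoint_inner_left,
      ContinuousLinearMap.adjoint_inner_left, ContinuousLinearMap.adjoint_inner_left]
  have hB : BddMeas fun θ => B' (W θ) := hW.comp B'.continuous
  have hH : BddMeas fun θ => H' (B' (W θ)) := hB.comp H'.continuous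
  simp only [hexp]
  rw [integral_add ((hH.inner he.bddMeas).integrable Q) ((hB.inner he'.bddMeas).integrable Q),
    he.integral_inner hQ hH fun i k => (hWq i k).comp fun w => H' (B' w),
    he'.integral_inner hQ hB fun i k => (hWq' i k).comp B', add_zero]

lemma integral_norm_sq_noise_le (hQ : IsInputLaw S Q)
    {qs' : ∀ i, Fin (n i) → DitherIndex S.m} {Δ' : ℝ}
    {ev' : Inputs S.m → PiLp 2 fun i => EuclideanSpace ℝ (Fin (n i))}
    (he : IsDitherVec S qs Δ ev) (he' : IsDitherVec S qs' Δ' ev')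
    (hq : ∀ i k, IgnoresDither (qs' i k) ev)
    (H : (PiLp 2 fun i => EuclideanSpace ℝ (Fin (n i)))
      →L[ℝ] PiLp 2 fun i => EuclideanSpace ℝ (Fin (n i)))
    {L : ℝ} (hL : ∀ x, ‖H x‖ ≤ L * ‖x‖) {K : ℝ} (hK : (∑ i, n i : ℕ) ≤ K) :
    ∫ θ, ‖H (ev θ) + ev' θ‖ ^ 2 ∂Q ≤ K / 12 * (L ^ 2 * Δ ^ 2 + Δ' ^ 2) := by
  have := hQ.isProbabilityMeasure
  have hH : BddMeas fun θ => H (ev θ) := he.bddMeas.comp H.continuous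
  have i1 := hH.norm_sq.integrable Q
  have hcross : ∫ θ, inner ℝ (H (ev θ)) (ev' θ) ∂Q = 0 :=
    he'.integral_inner hQ hH fun i k => (hq i k).comp H
  have h1 : ∫ θ, ‖H (ev θ)‖ ^ 2 ∂Q ≤ L ^ 2 * ∫ θ, ‖ev θ‖ ^ 2 ∂Q := by
    rw [← integral_const_mul]
    refine integral_mono i1 ((he.bddMeas.norm_sq.integrable Q).const_mul _) fun θ => ?_
    have := pow_le_pow_left₀ (norm_nonneg _) (hL (ev θ)) 2
    rwa [mul_pow] at this
  rw [integral_norm_add_sq Q hH he'.bddMeas, hcross, he'.integral_norm_sq hQ]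
  rw [he.integral_norm_sq hQ] at h1
  have h2 : L ^ 2 * ((∑ i, n i : ℕ) * (Δ ^ 2 / 12)) ≤ L ^ 2 * (K * (Δ ^ 2 / 12)) := by gcongr
  have h3 : (∑ i, n i : ℕ) * (Δ' ^ 2 / 12) ≤ K * (Δ' ^ 2 / 12) := by gcongr
  linarith

end DitherError

/-! ### Neighborhoods, selection maps and local vectors -/

section Geometry

variable {N : ℕ} {m : Fin N → ℕ} {𝒢 : SimpleGraph (Fin N)}

lemma mem_nbr_comm {i j : Fin N} : i ∈ nbr 𝒢 j ↔ j ∈ nbr 𝒢 i := by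
  simp [nbr, eq_comm, 𝒢.adj_comm]

/-- `select` as a continuous linear map. -/
noncomputable def selectL (𝒢 : SimpleGraph (Fin N)) (i : Fin N) : State m →L[ℝ] LocalState m 𝒢 i :=
  LinearMap.toContinuousLinearMap
    { toFun := select 𝒢 i
      map_add' := fun _ _ => rfl
      map_smul' := fun _ _ => rfl }

@[simp] lemma selectL_apply (i : Fin N) (x : State m) : selectL 𝒢 i x = select 𝒢 i x := rfl

lemma select_sub (i : Fin N) (x y : State m) : select 𝒢 i (x - y) = select 𝒢 i x - select 𝒢 i y :=
  rfl

lemma norm_select_le (i : Fin N) (x : State m) : ‖select 𝒢 i x‖ ≤ ‖x‖ := by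
  refine (sq_le_sq₀ (norm_nonneg _) (norm_nonneg _)).1 ?_
  rw [PiLp.norm_sq_eq_of_L2, PiLp.norm_sq_eq_of_L2]
  change ∑ j : {j // j ∈ nbr 𝒢 i}, ‖x j.1‖ ^ 2 ≤ _
  rw [Finset.sum_coe_sort (nbr 𝒢 i) fun j => ‖x j‖ ^ 2]
  exact Finset.sum_le_sum_of_subset_of_nonneg (Finset.subset_univ _) fun _ _ _ => by positivity

/-- The extension by zero of a local vector of node `j` to all nodes, the adjoint of the
selection map. -/
noncomputable def embed (𝒢 : SimpleGraph (Fin N)) (j : Fin N) : LocalState m 𝒢 j →L[ℝ] State m :=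
  ContinuousLinearMap.adjoint (selectL 𝒢 j)

lemma toLp_comp_eq_embed (j : Fin N) (y : LocalState m 𝒢 j) :
    (WithLp.toLp 2 fun i => comp i j y : State m) = embed 𝒢 j y := by
  refine ext_inner_left ℝ fun x => ?_
  rw [embed, ContinuousLinearMap.adjoint_inner_right, selectL_apply, PiLp.inner_apply,
    PiLp.inner_apply]
  have h : ∀ i, inner ℝ (x i) (comp i j y)
      = if h : i ∈ nbr 𝒢 j then inner ℝ (x i) (y ⟨i, h⟩) else 0 := by
    intro i
    unfold comp
    split_ifs <;> simp
  simp only [h]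
  rw [Finset.sum_dite]
  simp only [Finset.sum_const_zero, add_zero]
  refine Finset.sum_bij (fun i _ => ⟨i.1, by simpa using i.2⟩) (fun _ _ => Finset.mem_univ _)
    (fun a _ b _ hab => Subtype.ext (by simpa using hab))
    (fun b _ => ⟨⟨b.1, by simp⟩, Finset.mem_univ _, rfl⟩) fun i _ => rfl

lemma embed_apply (i j : Fin N) (y : LocalState m 𝒢 j) : embed 𝒢 j y i = comp i j y := by
  rw [← toLp_comp_eq_embed]

lemma norm_embed_le (j : Fin N) (y : LocalState m 𝒢 j) : ‖embed 𝒢 j y‖ ≤ ‖y‖ := by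
  have h : ‖embed 𝒢 j y‖ ^ 2 ≤ ‖embed 𝒢 j y‖ * ‖y‖ := by
    rw [← real_inner_self_eq_norm_sq]
    conv_lhs => rw [embed, ContinuousLinearMap.adjoint_inner_right, selectL_apply]
    refine (real_inner_le_norm _ _).trans ?_
    gcongr
    exact norm_select_le _ _
  by_contra! hlt
  nlinarith [norm_nonneg y]

/-- A local vector has at most `D · mbar` coordinates. -/
lemma sum_local_dim_le (S : Setup N) (l : Fin N) :
    ((∑ j : {j // j ∈ nbr S.graph l}, S.m j.1 : ℕ) : ℝ) ≤ S.D * S.mbar := by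
  have h : ∑ j : {j // j ∈ nbr S.graph l}, S.m j.1 ≤ S.D * S.mbar := by
    calc ∑ j : {j // j ∈ nbr S.graph l}, S.m j.1
        ≤ ∑ _j : {j // j ∈ nbr S.graph l}, S.mbar :=
          Finset.sum_le_sum fun j _ => Finset.le_sup (f := S.m) (Finset.mem_univ j.1)
      _ = (nbr S.graph l).card * S.mbar := by simp
      _ ≤ S.D * S.mbar := Nat.mul_le_mul_right _
          (Finset.le_sup (f := fun i => (nbr S.graph i).card) (Finset.mem_univ l))
  exact_mod_cast h

end Geometry

/-! ### The smooth part of the objective -/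

namespace Setup

variable {N : ℕ} (S : Setup N)

/-- The standing assumptions on the algorithm and the objective, with a common Lipschitz constant
`L` of the local gradients. -/
structure Admissible (L : ℝ≥0) : Prop where
  nonempty : Nonempty (Fin N)
  T_pos : 0 < S.T
  η_pos : 0 < S.η
  step_pos : ∀ q, 0 < S.ditherStep q
  convex : ∀ i, ConvexOn ℝ Set.univ (S.f i)
  diff : ∀ i, Differentiable ℝ (S.f i)
  lip : ∀ i, LipschitzWith L (gradient (S.f i))
  reg : IsRegularizer S.R
  prox_apply : ∀ (v : State S.m) (i : Fin N), prox S.η S.R v i = prox S.η (S.Rloc i) (v i)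

/-- The linear parts of the local gradients. -/
structure IsHessian (H : ∀ l, LocalState S.m S.graph l →L[ℝ] LocalState S.m S.graph l) : Prop where
  gradient_sub : ∀ l z w, gradient (S.f l) z - gradient (S.f l) w = H l (z - w)

/-- The local objective of node `l` as a function of the whole state. -/
noncomputable def fState (l : Fin N) (x : State S.m) : ℝ := S.f l (select S.graph l x)

variable {S} {L : ℝ≥0}

lemma IsHessian.norm_le
    {H : ∀ l, LocalState S.m S.graph l →L[ℝ] LocalState S.m S.graph l} (hH : S.IsHessian H)
    (hS : S.Admissible L) (l : Fin N) (d : LocalState S.m S.graph l) : ‖H l d‖ ≤ L * ‖d‖ := by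
  have h1 := hH.gradient_sub l d 0
  have h2 := (hS.lip l).norm_sub_le d 0
  rw [h1, sub_zero] at h2
  exact h2

namespace Admissible

variable (hS : S.Admissible L)

include hS

lemma card_pos : (0 : ℝ) < N := by
  have := hS.nonempty
  have h : 0 < N := Fin.pos_iff_nonempty.2 this
  exact_mod_cast h

lemma hasGradientAt_fState (l : Fin N) (x : State S.m) :
    HasGradientAt (S.fState l) (embed S.graph l (gradient (S.f l) (select S.graph l x))) x := by
  rw [hasGradientAt_iff_hasFDerivAt]
  have h1 := (hS.diff l (select S.graph l x)).hasGradientAt.hasFDerivAt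
  have h2 := h1.comp x (selectL S.graph l).hasFDerivAt
  refine h2.congr_fderiv ?_
  ext d
  simp only [ContinuousLinearMap.comp_apply, InnerProductSpace.toDual_apply_apply, embed,
    ContinuousLinearMap.adjoint_inner_left]

lemma gradient_fState (l : Fin N) (x : State S.m) :
    gradient (S.fState l) x = embed S.graph l (gradient (S.f l) (select S.graph l x)) :=
  (hS.hasGradientAt_fState l x).gradient

lemma differentiable_fState (l : Fin N) : Differentiable ℝ (S.fState l) := fun x =>
  (hS.hasGradientAt_fState l x).differentiableAt

lemma convexOn_fState (l : Fin N) : ConvexOn ℝ Set.univ (S.fState l) := by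
  exact (hS.convex l).comp_linearMap (selectL S.graph l).toLinearMap

lemma lipschitz_fState (l : Fin N) : LipschitzWith L (gradient (S.fState l)) := by
  refine LipschitzWith.of_dist_le_mul fun x y => ?_
  rw [dist_eq_norm, dist_eq_norm, hS.gradient_fState, hS.gradient_fState, ← map_sub]
  refine (norm_embed_le _ _).trans (((hS.lip l).norm_sub_le _ _).trans ?_)
  rw [← select_sub]
  gcongr
  exact norm_select_le _ _

lemma continuous_gradient_fState (l : Fin N) : Continuous (gradient (S.fState l)) :=
  (hS.lipschitz_fState l).continuous

lemma hasGradientAt_F (x : State S.m) :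
    HasGradientAt S.F ((1 / N : ℝ) • ∑ l, gradient (S.fState l) x) x := by
  rw [hasGradientAt_iff_hasFDerivAt]
  have h1 : HasFDerivAt (fun x => ∑ l, S.fState l x)
      (∑ l, InnerProductSpace.toDual ℝ _ (gradient (S.fState l) x)) x :=
    HasFDerivAt.fun_sum fun l _ => (hS.differentiable_fState l x).hasGradientAt.hasFDerivAt
  have h2 := h1.const_mul (1 / N : ℝ)
  refine h2.congr_fderiv ?_
  simp

lemma gradient_F (x : State S.m) :
    gradient S.F x = (1 / N : ℝ) • ∑ l, gradient (S.fState l) x :=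
  (hS.hasGradientAt_F x).gradient

lemma differentiable_F : Differentiable ℝ S.F := fun x => (hS.hasGradientAt_F x).differentiableAt

omit hS in
lemma F_eq : S.F = fun x => (1 / N : ℝ) * ∑ l, S.fState l x := rfl

lemma convexOn_F : ConvexOn ℝ Set.univ S.F := by
  have h : ConvexOn ℝ Set.univ (∑ l, S.fState l) := by
    refine Finset.sum_induction _ (ConvexOn ℝ Set.univ) (fun _ _ => ConvexOn.add)
      (convexOn_const 0 convex_univ) fun l _ => hS.convexOn_fState l
  have h2 := h.smul (c := (1 / N : ℝ)) (by positivity)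
  have e : S.F = fun x => (1 / N : ℝ) • (∑ l, S.fState l) x := by
    rw [F_eq]
    funext x
    simp
  rw [e]
  exact h2

lemma lipschitz_F : LipschitzWith L (gradient S.F) := by
  have hN := hS.card_pos
  refine LipschitzWith.of_dist_le_mul fun x y => ?_
  rw [dist_eq_norm, dist_eq_norm, hS.gradient_F, hS.gradient_F, ← smul_sub,
    ← Finset.sum_sub_distrib, norm_smul, Real.norm_of_nonneg (by positivity)]
  calc (1 / N : ℝ) * ‖∑ l, (gradient (S.fState l) x - gradient (S.fState l) y)‖
      ≤ 1 / N * ∑ _l : Fin N, L * ‖x - y‖ := by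
        gcongr
        exact norm_sum_le_of_le _ fun l _ => (hS.lipschitz_fState l).norm_sub_le x y
    _ = L * ‖x - y‖ := by
        simp only [Finset.sum_const, Finset.card_univ, Fintype.card_fin, nsmul_eq_mul]
        field_simp

end Admissible

/-! ### The objective on its domain -/

/-- The optimality gap `G(x) - G(x⋆)` as a real number; it is meaningful on the domain of `R`. -/
noncomputable def gap (S : Setup N) (xstar x : State S.m) : ℝ :=
  S.F x + (S.R x).toReal - (S.F xstar + (S.R xstar).toReal)

namespace Admissible

variable (hS : S.Admissible L)

include hS

lemma coe_G {x : State S.m} (hx : x ∈ effDom S.R) :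
    S.G x = ((S.F x + (S.R x).toReal : ℝ) : EReal) := by
  rw [G, EReal.coe_add, hS.reg.coe_toReal hx]

lemma effDom_G : effDom S.G = effDom S.R := by
  ext x
  by_cases hx : x ∈ effDom S.R
  · refine iff_of_true ?_ hx
    change S.G x < ⊤
    rw [hS.coe_G hx]
    exact EReal.coe_lt_top _
  · refine iff_of_false ?_ hx
    change ¬ S.G x < ⊤
    rw [G, hS.reg.eq_top hx, EReal.coe_add_top]
    exact lt_irrefl _

lemma convexOn_objective : ConvexOn ℝ (effDom S.R) (fun x => S.F x + (S.R x).toReal) :=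
  (hS.convexOn_F.subset (Set.subset_univ _) hS.reg.convexOn.1).add hS.reg.convexOn

lemma measurable_gap (xstar : State S.m) : Measurable (S.gap xstar) :=
  (hS.differentiable_F.continuous.measurable.add
    (measurable_ereal_toReal.comp hS.reg.lsc.measurable)).sub_const _

variable {xstar : State S.m} (hxstar : ∀ z, S.G xstar ≤ S.G z)

include hxstar

lemma xstar_mem : xstar ∈ effDom S.R := by
  obtain ⟨x, hx⟩ := hS.reg.dom_nonempty
  rw [← hS.effDom_G] at hx ⊢
  exact (hxstar x).trans_lt hx

lemma gap_nonneg {x : State S.m} (hx : x ∈ effDom S.R) : 0 ≤ S.gap xstar x := by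
  have h := hxstar x
  rw [hS.coe_G hx, hS.coe_G (hS.xstar_mem hxstar), EReal.coe_le_coe_iff] at h
  exact sub_nonneg.2 h

/-- The expected smoothness of the local gradients, relative to the minimizer. -/
lemma sum_norm_gradient_sub_sq_le {x : State S.m} (hx : x ∈ effDom S.R) :
    1 / N * ∑ l, ‖gradient (S.fState l) x - gradient (S.fState l) xstar‖ ^ 2
      ≤ 2 * L * S.gap xstar x := by
  have hN := hS.card_pos
  -- optimality of the minimizer: `-∇F(x⋆)` is a subgradient of `R`
  have hopt := IsMinOn_add_variational (φ := S.F) (g := gradient S.F xstar) (c := L / 2)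
    hS.reg.convexOn
    (fun z => le_quadratic_of_lipschitz_gradient hS.differentiable_F hS.lipschitz_F xstar z)
    (hS.xstar_mem hxstar) (fun z hz => by
      have := hS.gap_nonneg hxstar hz
      unfold gap at this
      linarith) hx
  have hsum : ∑ l, ‖gradient (S.fState l) x - gradient (S.fState l) xstar‖ ^ 2
      ≤ ∑ l, 2 * L * (S.fState l x - S.fState l xstar
        - Inner.inner ℝ (gradient (S.fState l) xstar) (x - xstar)) :=
    Finset.sum_le_sum fun l _ => norm_gradient_sub_sq_le (hS.differentiable_fState l)
      (hS.convexOn_fState l) (hS.lipschitz_fState l) x xstar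
  have hF : 1 / N * ∑ l, 2 * L * (S.fState l x - S.fState l xstar
        - Inner.inner ℝ (gradient (S.fState l) xstar) (x - xstar))
      = 2 * L * (S.F x - S.F xstar - Inner.inner ℝ (gradient S.F xstar) (x - xstar)) := by
    rw [hS.gradient_F, real_inner_smul_left, sum_inner, F_eq, ← Finset.mul_sum,
      Finset.sum_sub_distrib, Finset.sum_sub_distrib]
    ring
  calc _ ≤ 1 / (N : ℝ) * ∑ l, 2 * L * (S.fState l x - S.fState l xstar
        - Inner.inner ℝ (gradient (S.fState l) xstar) (x - xstar)) := by gcongr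
    _ = _ := hF
    _ ≤ _ := by
      gcongr
      unfold gap
      linarith

/-- Quadratic growth of a strongly convex objective at its minimizer. -/
lemma norm_sub_sq_le_gap {μ : ℝ} (hstrong : IsStronglyConvex μ S.G) {x : State S.m}
    (hx : x ∈ effDom S.R) : μ / 2 * ‖x - xstar‖ ^ 2 ≤ S.gap xstar x := by
  have hmem := hS.xstar_mem hxstar
  have h := hstrong x (by rwa [hS.effDom_G]) xstar (by rwa [hS.effDom_G]) 0
    (fun z => by simpa using hxstar z)
  rw [hS.coe_G hx, hS.coe_G hmem, ← EReal.coe_add, EReal.coe_le_coe_iff, inner_zero_left] at h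
  unfold gap
  linarith

omit hxstar in
lemma gap_average_le {T : ℕ} (hT : 0 < T) {x : ℕ → State S.m} (hx : ∀ t < T, x t ∈ effDom S.R) :
    S.gap xstar ((1 / T : ℝ) • ∑ t ∈ Finset.range T, x t)
      ≤ 1 / T * ∑ t ∈ Finset.range T, S.gap xstar (x t) := by
  have hT' : (0 : ℝ) < T := by exact_mod_cast hT
  have h := hS.convexOn_objective.map_sum_le (t := Finset.range T) (w := fun _ => (1 / T : ℝ))
    (p := x) (fun _ _ => by positivity) (by simp; field_simp)
    (fun t ht => hx t (Finset.mem_range.1 ht))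
  rw [← Finset.smul_sum] at h
  simp only [smul_eq_mul, ← Finset.mul_sum] at h
  have e : 1 / T * ∑ t ∈ Finset.range T, S.gap xstar (x t)
      = 1 / T * ∑ t ∈ Finset.range T, (S.F (x t) + (S.R (x t)).toReal)
        - (S.F xstar + (S.R xstar).toReal) := by
    unfold gap
    rw [Finset.sum_sub_distrib, Finset.sum_const, Finset.card_range, nsmul_eq_mul]
    field_simp
  rw [e]
  unfold gap
  linarith

omit hxstar in
lemma average_mem {T : ℕ} (hT : 0 < T) {x : ℕ → State S.m} (hx : ∀ t < T, x t ∈ effDom S.R) :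
    (1 / T : ℝ) • ∑ t ∈ Finset.range T, x t ∈ effDom S.R := by
  have hT' : (0 : ℝ) < T := by exact_mod_cast hT
  rw [Finset.smul_sum]
  exact hS.reg.convexOn.1.sum_mem (fun _ _ => by positivity) (by simp; field_simp)
    (fun t ht => hx t (Finset.mem_range.1 ht))

end Admissible

end Setup

/-! ### Which inputs the iterates depend on -/

/-- The outer iteration in which a dither is used. -/
def DitherIndex.outerTime {N : ℕ} {m : Fin N → ℕ} : DitherIndex m → ℕ
  | .a s _ _ => s
  | .b s _ _ _ => s
  | .c s _ _ _ => s
  | .d s _ _ _ _ => s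

/-- The stage of its outer iteration in which a dither is used: `0` for the quantizations at the
beginning of the outer iteration, and `t + 1` for inner iteration `t`. -/
def DitherIndex.innerTime {N : ℕ} {m : Fin N → ℕ} : DitherIndex m → ℕ
  | .a _ _ _ => 0
  | .b _ _ _ _ => 0
  | .c _ t _ _ => t + 1
  | .d _ t _ _ _ => t + 1

namespace Setup

variable {N : ℕ} {S : Setup N} {L : ℝ≥0}

section Congr

variable {ν ν' : DitherIndex S.m → ℝ} {ell ell' : ℕ → ℕ → Fin N} {s t : ℕ}

lemma xhat_congr (h : ∀ i k, ν (.a s i k) = ν' (.a s i k)) (o : S.Outer) :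
    S.xhat ν s o = S.xhat ν' s o := by
  unfold xhat
  simp only [h]

lemma grad_congr (h : ∀ i k, ν (.a s i k) = ν' (.a s i k)) (o : S.Outer) :
    S.grad ν s o = S.grad ν' s o := by
  unfold grad
  rw [xhat_congr h]

lemma ghat_congr (h : ∀ q : DitherIndex S.m, q.outerTime = s → q.innerTime = 0 → ν q = ν' q)
    (o : S.Outer) : S.ghat ν s o = S.ghat ν' s o := by
  unfold ghat
  rw [grad_congr (fun i k => h _ rfl rfl)]
  simp only [fun i j k => h (.b s i j k) rfl rfl]

lemma xhatIn_congr (ha : ∀ i k, ν (.a s i k) = ν' (.a s i k))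
    (hc : ∀ i k, ν (.c s t i k) = ν' (.c s t i k)) (o : S.Outer) (x : State S.m) :
    S.xhatIn ν s t o x = S.xhatIn ν' s t o x := by
  unfold xhatIn
  rw [xhat_congr ha]
  simp only [hc]

lemma gradIn_congr (ha : ∀ i k, ν (.a s i k) = ν' (.a s i k))
    (hc : ∀ i k, ν (.c s t i k) = ν' (.c s t i k)) (o : S.Outer) (x : State S.m) :
    S.gradIn ν s t o x = S.gradIn ν' s t o x := by
  unfold gradIn
  rw [xhatIn_congr ha hc]

lemma ghatIn_congr
    (h : ∀ q : DitherIndex S.m, q.outerTime = s → q.innerTime ≤ t + 1 → ν q = ν' q)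
    (o : S.Outer) (x : State S.m) : S.ghatIn ν s t o x = S.ghatIn ν' s t o x := by
  unfold ghatIn
  rw [ghat_congr (fun q h1 h2 => h q h1 (by omega)),
    gradIn_congr (fun i k => h _ rfl (Nat.zero_le _)) (fun i k => h _ rfl le_rfl)]
  simp only [fun i j k => h (.d s t i j k) rfl le_rfl]

lemma dir_congr
    (h : ∀ q : DitherIndex S.m, q.outerTime = s → q.innerTime ≤ t + 1 → ν q = ν' q)
    (hell : ell s t = ell' s t) (o : S.Outer) (x : State S.m) :
    S.dir ν ell s t o x = S.dir ν' ell' s t o x := by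
  unfold dir vcorr htil
  rw [ghat_congr (fun q h1 h2 => h q h1 (by omega)), ghatIn_congr h, hell]

lemma inner_congr
    (h : ∀ q : DitherIndex S.m, q.outerTime = s → q.innerTime ≤ t → ν q = ν' q)
    (hell : ∀ t' < t, ell s t' = ell' s t') (o : S.Outer) :
    S.inner ν ell s o t = S.inner ν' ell' s o t := by
  induction t with
  | zero => rfl
  | succ t ih =>
    simp only [inner]
    rw [ih (fun q h1 h2 => h q h1 (by omega)) (fun t' ht' => hell t' (by omega)),
      dir_congr h (hell t (by omega))]

lemma outer_congr (h : ∀ q : DitherIndex S.m, q.outerTime < s → ν q = ν' q)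
    (hell : ∀ a b, a < s → ell a b = ell' a b) : S.outer ν ell s = S.outer ν' ell' s := by
  induction s with
  | zero => rfl
  | succ s ih =>
    simp only [outer]
    rw [ih (fun q hq => h q (by omega)) (fun a b ha => hell a b (by omega)),
      xhat_congr (fun i k => h _ (Nat.lt_succ_self s)),
      ghat_congr (fun q h1 _ => h q (by omega))]
    congr 2
    refine Finset.sum_congr rfl fun t _ => ?_
    exact inner_congr (fun q h1 _ => h q (by omega)) (fun t' _ => hell s t' (by omega)) _

end Congr

section Ignores

variable {s t : ℕ} {q : DitherIndex S.m}

lemma ignoresDither_outer (h : s ≤ q.outerTime) :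
    IgnoresDither q fun θ => S.outer θ.1 θ.2 s := fun ν ν' ell hν =>
  outer_congr (fun q' hq' => hν q' fun e => by subst e; omega) fun _ _ _ => rfl

lemma ignoresDither_xin (h : s ≤ q.outerTime) (h' : q.outerTime = s → t < q.innerTime) :
    IgnoresDither q fun θ => S.xin θ.1 θ.2 s t := fun ν ν' ell hν => by
  change S.xin ν ell s t = S.xin ν' ell s t
  unfold xin
  rw [show S.outer ν ell s = S.outer ν' ell s from ignoresDither_outer h ν ν' ell hν]
  exact inner_congr
    (fun q' h1 h2 => hν q' fun e => by subst e; have := h' h1; omega) (fun _ _ => rfl) _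

lemma ignoresDither_ghat (h : s ≤ q.outerTime) (h' : 0 < q.innerTime) :
    IgnoresDither q fun θ => S.ghat θ.1 s (S.outer θ.1 θ.2 s) := fun ν ν' ell hν => by
  change S.ghat ν s (S.outer ν ell s) = S.ghat ν' s (S.outer ν' ell s)
  rw [show S.outer ν ell s = S.outer ν' ell s from ignoresDither_outer h ν ν' ell hν]
  exact ghat_congr (fun q' h1 h2 => hν q' fun e => by subst e; omega) _

lemma ignoresDither_xhat (h : s ≤ q.outerTime) (h' : ∀ i k, q ≠ .a s i k) :
    IgnoresDither q fun θ => S.xhat θ.1 s (S.outer θ.1 θ.2 s) := fun ν ν' ell hν => by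
  change S.xhat ν s (S.outer ν ell s) = S.xhat ν' s (S.outer ν' ell s)
  rw [show S.outer ν ell s = S.outer ν' ell s from ignoresDither_outer h ν ν' ell hν]
  exact xhat_congr (fun i k => hν _ (h' i k).symm) _

lemma ignoresDither_grad (h : s ≤ q.outerTime) (h' : ∀ i k, q ≠ .a s i k) :
    IgnoresDither q fun θ => S.grad θ.1 s (S.outer θ.1 θ.2 s) := fun ν ν' ell hν => by
  change S.grad ν s (S.outer ν ell s) = S.grad ν' s (S.outer ν' ell s)
  rw [show S.outer ν ell s = S.outer ν' ell s from ignoresDither_outer h ν ν' ell hν]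
  exact grad_congr (fun i k => hν _ (h' i k).symm) _

lemma ignoresDither_xhatIn (l i : Fin N) (k : Fin (S.m i)) :
    IgnoresDither (.d s t l i k) fun θ =>
      S.xhatIn θ.1 s t (S.outer θ.1 θ.2 s) (S.xin θ.1 θ.2 s t) := fun ν ν' ell hν => by
  change S.xhatIn ν s t (S.outer ν ell s) (S.xin ν ell s t)
    = S.xhatIn ν' s t (S.outer ν' ell s) (S.xin ν' ell s t)
  rw [show S.outer ν ell s = S.outer ν' ell s from ignoresDither_outer le_rfl ν ν' ell hν,
    show S.xin ν ell s t = S.xin ν' ell s t from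
      ignoresDither_xin le_rfl (fun _ => Nat.lt_succ_self t) ν ν' ell hν]
  exact xhatIn_congr (fun i k => hν _ (by simp)) (fun i k => hν _ (by simp)) _ _

lemma ignoresNode_outer : IgnoresNode s t fun θ => S.outer θ.1 θ.2 s := fun ν ell ell' h =>
  outer_congr (fun _ _ => rfl) fun a b ha => h a b (by simp; omega)

lemma ignoresNode_xin : IgnoresNode s t fun θ => S.xin θ.1 θ.2 s t := fun ν ell ell' h => by
  change S.xin ν ell s t = S.xin ν ell' s t
  unfold xin
  rw [show S.outer ν ell s = S.outer ν ell' s from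
    ignoresNode_outer (s := s) (t := t) ν ell ell' h]
  exact inner_congr (fun _ _ _ => rfl) (fun t' ht' => h s t' (by simp; omega)) _

end Ignores

/-! ### The algorithm as a proximal gradient iteration -/

section Formulas

lemma dir_eq_embed (ν : DitherIndex S.m → ℝ) (ell : ℕ → ℕ → Fin N) (s t : ℕ) (o : S.Outer)
    (x : State S.m) :
    S.dir ν ell s t o x
      = embed S.graph (ell s t) (S.ghatIn ν s t o x (ell s t))
        - embed S.graph (ell s t) (S.ghat ν s o (ell s t))
        + (1 / N : ℝ) • ∑ j, embed S.graph j (S.ghat ν s o j) := by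
  ext1 i
  have hh : S.htil ν s o i
      = ((1 / N : ℝ) • ∑ j, embed S.graph j (S.ghat ν s o j) : State S.m) i := by
    rw [htil, PiLp.smul_apply]
    congr 1
    rw [WithLp.ofLp_sum, Finset.sum_apply]
    simp only [embed_apply]
    refine Finset.sum_subset (Finset.subset_univ _) fun j _ hj => ?_
    rw [comp, dif_neg (mt mem_nbr_comm.1 hj)]
  rw [PiLp.add_apply, PiLp.sub_apply, embed_apply, embed_apply, ← hh]
  simp only [dir, vcorr]
  split_ifs with h
  · abel
  · rw [comp, comp, dif_neg h, dif_neg h]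
    abel

namespace Admissible

variable (hS : S.Admissible L)

include hS

lemma inner_succ (ν : DitherIndex S.m → ℝ) (ell : ℕ → ℕ → Fin N) (s t : ℕ) (o : S.Outer) :
    S.inner ν ell s o (t + 1)
      = prox S.η S.R (S.inner ν ell s o t - S.η • S.dir ν ell s t o (S.inner ν ell s o t)) := by
  ext1 i
  rw [hS.prox_apply]
  rfl

lemma xin_mem {ν : DitherIndex S.m → ℝ} {ell : ℕ → ℕ → Fin N} {s : ℕ}
    (h : S.xtilde ν ell s ∈ effDom S.R) (t : ℕ) : S.xin ν ell s t ∈ effDom S.R := by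
  cases t with
  | zero => exact h
  | succ t =>
    rw [xin, hS.inner_succ]
    exact hS.reg.prox_mem hS.η_pos _

lemma xtilde_mem (h0 : (0 : State S.m) ∈ effDom S.R) (ν : DitherIndex S.m → ℝ)
    (ell : ℕ → ℕ → Fin N) (s : ℕ) : S.xtilde ν ell s ∈ effDom S.R := by
  induction s with
  | zero => exact h0
  | succ s ih => exact hS.average_mem hS.T_pos fun t _ => hS.xin_mem ih (t + 1)

end Admissible

end Formulas

/-! ### Boundedness and measurability of the iterates -/

section Bounded

lemma bddMeas_ditherQuant {m : Fin N → ℕ} {Δ : ℝ} (hΔ : 0 < Δ) (q : DitherIndex m)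
    {zbar z : Inputs m → ℝ} (hzbar : BddMeas zbar) (hz : BddMeas z) :
    BddMeas fun θ => ditherQuant (zbar θ) Δ (θ.1 q) (z θ) := by
  have h : BddMeas fun θ : Inputs m => ditherQuant (zbar θ) Δ (θ.1 q) (z θ) - z θ :=
    ⟨(measurable_ditherQuant _ hzbar.1 ((measurable_pi_apply q).comp measurable_fst) hz.1).sub
      hz.1, _, fun θ => abs_ditherQuant_sub_le hΔ _ _ _⟩
  simpa using h.add hz

/-- What the nodes hold at the beginning of an outer iteration is bounded and measurable. -/
structure BddOuter (o : Inputs S.m → S.Outer) : Prop where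
  x : BddMeas fun θ => (o θ).x
  xhat : BddMeas fun θ => (o θ).xhat
  ghat : ∀ l, BddMeas fun θ => (o θ).ghat l

lemma bddMeas_apply {α : Type*} [MeasurableSpace α] {ι : Type*} [Fintype ι] {n : ι → ℕ}
    {f : α → PiLp 2 fun i => EuclideanSpace ℝ (Fin (n i))} (hf : BddMeas f) (i : ι)
    (k : Fin (n i)) : BddMeas fun a => f a i k :=
  hf.comp (g := fun w => w i k) (by fun_prop)

namespace Admissible

variable (hS : S.Admissible L) {o : Inputs S.m → S.Outer}

include hS

lemma continuous_gradient (l : Fin N) : Continuous (gradient (S.f l)) := (hS.lip l).continuous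

lemma bddMeas_xhat (ho : BddOuter o) (s : ℕ) : BddMeas fun θ => S.xhat θ.1 s (o θ) := by
  unfold xhat
  exact BddMeas.toLp fun i => BddMeas.toLp fun k => bddMeas_ditherQuant (hS.step_pos (.a s i k)) _
    (bddMeas_apply ho.xhat i k) (bddMeas_apply ho.x i k)

lemma bddMeas_grad (ho : BddOuter o) (s : ℕ) (l : Fin N) :
    BddMeas fun θ => S.grad θ.1 s (o θ) l :=
  (hS.bddMeas_xhat ho s).comp (g := fun x => gradient (S.f l) (select S.graph l x))
    ((hS.continuous_gradient l).comp (selectL S.graph l).continuous)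

lemma bddMeas_ghat (ho : BddOuter o) (s : ℕ) (l : Fin N) :
    BddMeas fun θ => S.ghat θ.1 s (o θ) l := by
  unfold ghat
  exact BddMeas.toLp fun i => BddMeas.toLp fun k =>
    bddMeas_ditherQuant (hS.step_pos (.b s l i.1 k)) _
      (bddMeas_apply (ho.ghat l) i k) (bddMeas_apply (hS.bddMeas_grad ho s l) i k)

variable {x : Inputs S.m → State S.m}

lemma bddMeas_xhatIn (ho : BddOuter o) (hx : BddMeas x) (s t : ℕ) :
    BddMeas fun θ => S.xhatIn θ.1 s t (o θ) (x θ) := by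
  unfold xhatIn
  exact BddMeas.toLp fun i => BddMeas.toLp fun k =>
    bddMeas_ditherQuant (hS.step_pos (.c s t i k)) _
      (bddMeas_apply (hS.bddMeas_xhat ho s) i k) (bddMeas_apply hx i k)

lemma bddMeas_gradIn (ho : BddOuter o) (hx : BddMeas x) (s t : ℕ) (l : Fin N) :
    BddMeas fun θ => S.gradIn θ.1 s t (o θ) (x θ) l :=
  (hS.bddMeas_xhatIn ho hx s t).comp (g := fun x => gradient (S.f l) (select S.graph l x))
    ((hS.continuous_gradient l).comp (selectL S.graph l).continuous)

lemma bddMeas_ghatIn (ho : BddOuter o) (hx : BddMeas x) (s t : ℕ) (l : Fin N) :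
    BddMeas fun θ => S.ghatIn θ.1 s t (o θ) (x θ) l := by
  unfold ghatIn
  exact BddMeas.toLp fun i => BddMeas.toLp fun k =>
    bddMeas_ditherQuant (hS.step_pos (.d s t l i.1 k)) _
      (bddMeas_apply (hS.bddMeas_ghat ho s l) i k)
      (bddMeas_apply (hS.bddMeas_gradIn ho hx s t l) i k)

lemma bddMeas_dir (ho : BddOuter o) (hx : BddMeas x) (s t : ℕ) :
    BddMeas fun θ => S.dir θ.1 θ.2 s t (o θ) (x θ) := by
  simp only [dir_eq_embed]
  have hg : ∀ l, BddMeas fun θ => embed S.graph l (S.ghat θ.1 s (o θ) l) := fun l =>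
    (hS.bddMeas_ghat ho s l).comp (embed S.graph l).continuous
  have hgIn : ∀ l, BddMeas fun θ => embed S.graph l (S.ghatIn θ.1 s t (o θ) (x θ) l) := fun l =>
    (hS.bddMeas_ghatIn ho hx s t l).comp (embed S.graph l).continuous
  have hell : Measurable fun θ : Inputs S.m => θ.2 s t :=
    measurable_pi_iff.1 (measurable_pi_iff.1 measurable_snd s) t
  exact ((BddMeas.select hgIn hell).sub (BddMeas.select hg hell)).add
    ((BddMeas.sum _ fun l _ => hg l).comp (continuous_const_smul _))

lemma bddMeas_inner (ho : BddOuter o) (s t : ℕ) :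
    BddMeas fun θ => S.inner θ.1 θ.2 s (o θ) t := by
  induction t with
  | zero => exact ho.x
  | succ t ih =>
    simp only [hS.inner_succ]
    exact (ih.sub ((hS.bddMeas_dir ho ih s t).comp (continuous_const_smul S.η))).comp
      (hS.reg.continuous_prox hS.η_pos)

lemma bddOuter (s : ℕ) : BddOuter fun θ : Inputs S.m => S.outer θ.1 θ.2 s := by
  induction s with
  | zero => exact ⟨BddMeas.const 0, BddMeas.const 0, fun l => BddMeas.const 0⟩
  | succ s ih =>
    exact ⟨(BddMeas.sum _ fun t _ => hS.bddMeas_inner ih s (t + 1)).comp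
      (continuous_const_smul _), hS.bddMeas_xhat ih s, hS.bddMeas_ghat ih s⟩

lemma bddMeas_xin (s t : ℕ) : BddMeas fun θ : Inputs S.m => S.xin θ.1 θ.2 s t :=
  hS.bddMeas_inner (hS.bddOuter s) s t

lemma bddMeas_xtilde (s : ℕ) : BddMeas fun θ : Inputs S.m => S.xtilde θ.1 θ.2 s :=
  (hS.bddOuter s).x

end Admissible

end Bounded

end Setup

/-! ### Estimators built from one randomly chosen node -/

section Estimator

variable {N : ℕ} {V : Type*} [NormedAddCommGroup V] [InnerProductSpace ℝ V]

lemma sum_sub_mean (hN : (0 : ℝ) < N) (u : Fin N → V) :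
    ∑ l, (u l - (1 / N : ℝ) • ∑ j, u j) = 0 := by
  rw [Finset.sum_sub_distrib, Finset.sum_const, Finset.card_univ, Fintype.card_fin,
    ← Nat.cast_smul_eq_nsmul ℝ, smul_smul, mul_one_div_cancel hN.ne', one_smul, sub_self]

lemma sum_norm_sub_mean_sq_le (hN : (0 : ℝ) < N) (u : Fin N → V) :
    ∑ l, ‖u l - (1 / N : ℝ) • ∑ j, u j‖ ^ 2 ≤ ∑ l, ‖u l‖ ^ 2 := by
  set w := (1 / N : ℝ) • ∑ j, u j with hw
  have h : ∀ l, ‖u l‖ ^ 2 = ‖u l - w‖ ^ 2 + 2 * inner ℝ (u l - w) w + ‖w‖ ^ 2 := fun l => by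
    rw [← norm_add_sq_real, sub_add_cancel]
  have h0 : ∑ l, inner ℝ (u l - w) w = 0 := by
    rw [← sum_inner, sum_sub_mean hN, inner_zero_left]
  simp only [h]
  rw [Finset.sum_add_distrib, Finset.sum_add_distrib, ← Finset.mul_sum, h0]
  have : 0 ≤ ∑ _l : Fin N, ‖w‖ ^ 2 := by positivity
  linarith

variable {S : Setup N} {Q : Measure (Inputs S.m)} [FiniteDimensional ℝ V] [MeasurableSpace V]
  [BorelSpace V] {s t : ℕ} {A u : Fin N → Inputs S.m → V}

/-- The estimator `A_ℓ + (u_ℓ - mean u)` with the random node `ℓ` is orthogonal to everything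
that does not depend on `ℓ` and is orthogonal to the `A_l`. -/
lemma integral_inner_estimator (hQ : IsInputLaw S Q) (hN : (0 : ℝ) < N)
    (hA : ∀ l, BddMeas (A l)) (hu : ∀ l, BddMeas (u l)) (hAn : ∀ l, IgnoresNode s t (A l))
    (hun : ∀ l, IgnoresNode s t (u l)) {W : Inputs S.m → V} (hW : BddMeas W)
    (hWn : IgnoresNode s t W) (hWA : ∀ l, ∫ θ, inner ℝ (W θ) (A l θ) ∂Q = 0) :
    ∫ θ, inner ℝ (W θ) (A (θ.2 s t) θ + (u (θ.2 s t) θ - (1 / N : ℝ) • ∑ j, u j θ)) ∂Q = 0 := by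
  have := hQ.isProbabilityMeasure
  have : ProperSpace V := FiniteDimensional.proper_real V
  have hmean : BddMeas fun θ => (1 / N : ℝ) • ∑ j, u j θ :=
    (BddMeas.sum _ fun l _ => hu l).comp (continuous_const_smul _)
  have hmeann : IgnoresNode s t fun θ => (1 / N : ℝ) • ∑ j, u j θ := fun ν ell ell' h => by
    simp only [fun l => hun l ν ell ell' h]
  have h1 := hQ.integral_node s t
    (fun l θ => inner ℝ (W θ) (A l θ + (u l θ - (1 / N : ℝ) • ∑ j, u j θ)))
    (fun l => hW.inner ((hA l).add ((hu l).sub hmean)))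
    (fun l => hWn.comp₂ ((hAn l).comp₂ ((hun l).comp₂ hmeann (· - ·)) (· + ·)) (inner ℝ))
  rw [h1]
  have h2 : ∀ l, ∫ θ, inner ℝ (W θ) (A l θ + (u l θ - (1 / N : ℝ) • ∑ j, u j θ)) ∂Q
      = ∫ θ, inner ℝ (W θ) (u l θ - (1 / N : ℝ) • ∑ j, u j θ) ∂Q := fun l => by
    simp only [inner_add_right]
    rw [integral_add ((hW.inner (hA l)).integrable Q)
      ((hW.inner ((hu l).sub hmean)).integrable Q), hWA, zero_add]
  simp only [h2]
  rw [← integral_finsetSum _ fun l _ => (hW.inner ((hu l).sub hmean)).integrable Q]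
  simp only [← inner_sum, sum_sub_mean hN, inner_zero_right, integral_zero, mul_zero]

/-- The second moment of the estimator `A_ℓ + (u_ℓ - mean u)`, where the noise `A_l` is orthogonal
to `u_l - mean u`: the variance of `u_ℓ` is at most its second moment. -/
lemma integral_norm_sq_estimator_le (hQ : IsInputLaw S Q) (hN : (0 : ℝ) < N)
    (hA : ∀ l, BddMeas (A l)) (hu : ∀ l, BddMeas (u l)) (hAn : ∀ l, IgnoresNode s t (A l))
    (hun : ∀ l, IgnoresNode s t (u l))
    (hAu : ∀ l, ∫ θ, inner ℝ (u l θ - (1 / N : ℝ) • ∑ j, u j θ) (A l θ) ∂Q = 0) :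
    ∫ θ, ‖A (θ.2 s t) θ + (u (θ.2 s t) θ - (1 / N : ℝ) • ∑ j, u j θ)‖ ^ 2 ∂Q
      ≤ 1 / N * ∑ l, (∫ θ, ‖A l θ‖ ^ 2 ∂Q + ∫ θ, ‖u l θ‖ ^ 2 ∂Q) := by
  have := hQ.isProbabilityMeasure
  have : ProperSpace V := FiniteDimensional.proper_real V
  have hmean : BddMeas fun θ => (1 / N : ℝ) • ∑ j, u j θ :=
    (BddMeas.sum _ fun l _ => hu l).comp (continuous_const_smul _)
  have hmeann : IgnoresNode s t fun θ => (1 / N : ℝ) • ∑ j, u j θ := fun ν ell ell' h => by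
    simp only [fun l => hun l ν ell ell' h]
  have h1 := hQ.integral_node s t
    (fun l θ => ‖A l θ + (u l θ - (1 / N : ℝ) • ∑ j, u j θ)‖ ^ 2)
    (fun l => ((hA l).add ((hu l).sub hmean)).norm_sq)
    (fun l => ((hAn l).comp₂ ((hun l).comp₂ hmeann (· - ·)) (· + ·)).comp fun x => ‖x‖ ^ 2)
  rw [h1]
  have h2 : ∀ l, ∫ θ, ‖A l θ + (u l θ - (1 / N : ℝ) • ∑ j, u j θ)‖ ^ 2 ∂Q
      = ∫ θ, ‖A l θ‖ ^ 2 ∂Q + ∫ θ, ‖u l θ - (1 / N : ℝ) • ∑ j, u j θ‖ ^ 2 ∂Q := fun l => by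
    rw [integral_norm_add_sq Q (hA l) ((hu l).sub hmean)]
    simp only [fun θ => real_inner_comm (u l θ - (1 / N : ℝ) • ∑ j, u j θ) (A l θ), hAu l]
    ring
  simp only [h2, Finset.sum_add_distrib]
  gcongr 1 / (N : ℝ) * (_ + ?_)
  have hint : ∀ l, Integrable (fun θ => ‖u l θ - (1 / N : ℝ) • ∑ j, u j θ‖ ^ 2) Q := fun l =>
    (((hu l).sub hmean).norm_sq).integrable Q
  have hint' : ∀ l, Integrable (fun θ => ‖u l θ‖ ^ 2) Q := fun l => (hu l).norm_sq.integrable Q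
  rw [← integral_finsetSum _ fun l _ => hint l, ← integral_finsetSum _ fun l _ => hint' l]
  exact integral_mono (integrable_finsetSum _ fun l _ => hint l)
    (integrable_finsetSum _ fun l _ => hint' l) fun θ => sum_norm_sub_mean_sq_le hN fun l => u l θ

end Estimator

namespace Setup

variable {N : ℕ} {S : Setup N} {L : ℝ≥0}

/-! ### The noise of the transmitted gradients -/

section Noise

/-- The error of the quantized gradient of node `l` that is sent at the beginning of outer
iteration `s`, relative to the exact gradient at `x̃^(s)`. -/
noncomputable def anchorNoise (S : Setup N) (s : ℕ) (l : Fin N) (θ : Inputs S.m) : State S.m :=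
  embed S.graph l (S.ghat θ.1 s (S.outer θ.1 θ.2 s) l)
    - gradient (S.fState l) (S.xtilde θ.1 θ.2 s)

/-- The error of the quantized gradient that node `l` would send in inner iteration `t` of outer
iteration `s`, relative to the exact gradient at `x^(s_t)`. -/
noncomputable def innerNoise (S : Setup N) (s t : ℕ) (l : Fin N) (θ : Inputs S.m) : State S.m :=
  embed S.graph l (S.ghatIn θ.1 s t (S.outer θ.1 θ.2 s) (S.xin θ.1 θ.2 s t) l)
    - gradient (S.fState l) (S.xin θ.1 θ.2 s t)

/-- The change of the gradient of node `l` from its quantized value at `x̃^(s)` to its exact value at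
`x^(s_t)`; the algorithm's direction replaces the mean of these over all nodes by the value at the
chosen node. -/
noncomputable def controlled (S : Setup N) (s t : ℕ) (l : Fin N) (θ : Inputs S.m) : State S.m :=
  gradient (S.fState l) (S.xin θ.1 θ.2 s t)
    - (gradient (S.fState l) (S.xtilde θ.1 θ.2 s) + S.anchorNoise s l θ)

lemma ignoresNode_anchorNoise (s t : ℕ) (l : Fin N) : IgnoresNode s t (S.anchorNoise s l) :=
  fun ν ell ell' h => by
    have ho : S.outer ν ell s = S.outer ν ell' s :=
      ignoresNode_outer (s := s) (t := t) ν ell ell' h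
    simp only [anchorNoise, xtilde, ho]

lemma ignoresNode_innerNoise (s t : ℕ) (l : Fin N) : IgnoresNode s t (S.innerNoise s t l) :=
  fun ν ell ell' h => by
    have ho : S.outer ν ell s = S.outer ν ell' s :=
      ignoresNode_outer (s := s) (t := t) ν ell ell' h
    have hx : S.xin ν ell s t = S.xin ν ell' s t := ignoresNode_xin ν ell ell' h
    simp only [innerNoise, ho, hx]

lemma ignoresNode_controlled (s t : ℕ) (l : Fin N) : IgnoresNode s t (S.controlled s t l) :=
  (ignoresNode_xin.comp (gradient (S.fState l))).comp₂
    (((ignoresNode_outer (S := S)).comp fun o => gradient (S.fState l) o.x).comp₂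
      (ignoresNode_anchorNoise s t l) (· + ·)) (· - ·)

lemma ignoresDither_anchorNoise {s : ℕ} {q : DitherIndex S.m} (h : s ≤ q.outerTime)
    (h' : 0 < q.innerTime) (l : Fin N) : IgnoresDither q (S.anchorNoise s l) :=
  ((ignoresDither_ghat h h').comp fun g => embed S.graph l (g l)).comp₂
    ((ignoresDither_outer h).comp fun o => gradient (S.fState l) o.x) (· - ·)

lemma ignoresDither_controlled {s t : ℕ} {q : DitherIndex S.m} (h : s ≤ q.outerTime)
    (h' : t < q.innerTime) (l : Fin N) : IgnoresDither q (S.controlled s t l) :=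
  ((ignoresDither_xin h fun _ => h').comp (gradient (S.fState l))).comp₂
    (((ignoresDither_outer h).comp fun o => gradient (S.fState l) o.x).comp₂
      (ignoresDither_anchorNoise h (by omega) l) (· + ·)) (· - ·)

/-- The squared step sizes of outer iteration `s` are multiples of `κ^(s+1)`. -/
lemma step_sq (hκ : 0 < S.κ) (C : ℝ) (s : ℕ) :
    S.step C s ^ 2 = C ^ 2 / (2 ^ S.bits - 1) ^ 2 * S.κ ^ (s + 1) := by
  have h : (S.κ ^ (((s : ℝ) + 1) / 2)) ^ 2 = S.κ ^ (s + 1) := by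
    rw [← Real.rpow_natCast, ← Real.rpow_mul hκ.le, ← Real.rpow_natCast]
    congr 1
    push_cast
    ring
  rw [step, U, div_pow, mul_pow, h]
  ring

namespace Admissible

variable (hS : S.Admissible L)

include hS

/-- The direction of the algorithm is the exact gradient of `F` plus an estimator of zero. -/
lemma dir_sub_gradient_eq (θ : Inputs S.m) (s t : ℕ) :
    S.dir θ.1 θ.2 s t (S.outer θ.1 θ.2 s) (S.xin θ.1 θ.2 s t)
        - gradient S.F (S.xin θ.1 θ.2 s t)
      = S.innerNoise s t (θ.2 s t) θ
        + (S.controlled s t (θ.2 s t) θ - (1 / N : ℝ) • ∑ j, S.controlled s t j θ) := by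
  rw [dir_eq_embed, hS.gradient_F]
  simp only [controlled, innerNoise, anchorNoise, Finset.sum_sub_distrib, smul_sub,
    add_sub_cancel]
  abel

/-- The error of the algorithm's direction relative to the exact variance-reduced one. -/
lemma err_eq (θ : Inputs S.m) (s t : ℕ) :
    S.err θ.1 θ.2 s t = S.innerNoise s t (θ.2 s t) θ
      + (-S.anchorNoise s (θ.2 s t) θ - (1 / N : ℝ) • ∑ j, -S.anchorNoise s j θ) := by
  change S.dir θ.1 θ.2 s t (S.outer θ.1 θ.2 s) (S.xin θ.1 θ.2 s t)
    - (gradient (S.fState (θ.2 s t)) (S.xin θ.1 θ.2 s t)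
        - gradient (S.fState (θ.2 s t)) (S.xtilde θ.1 θ.2 s)
        + gradient S.F (S.xtilde θ.1 θ.2 s)) = _
  rw [dir_eq_embed, hS.gradient_F]
  simp only [innerNoise, anchorNoise, Finset.sum_sub_distrib, smul_sub, neg_sub]
  abel

lemma bddMeas_anchorNoise (s : ℕ) (l : Fin N) : BddMeas (S.anchorNoise s l) :=
  ((hS.bddMeas_ghat (hS.bddOuter s) s l).comp (embed S.graph l).continuous).sub
    ((hS.bddMeas_xtilde s).comp (hS.continuous_gradient_fState l))

lemma bddMeas_innerNoise (s t : ℕ) (l : Fin N) : BddMeas (S.innerNoise s t l) :=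
  ((hS.bddMeas_ghatIn (hS.bddOuter s) (hS.bddMeas_xin s t) s t l).comp
    (embed S.graph l).continuous).sub
    ((hS.bddMeas_xin s t).comp (hS.continuous_gradient_fState l))

lemma bddMeas_controlled (s t : ℕ) (l : Fin N) : BddMeas (S.controlled s t l) :=
  ((hS.bddMeas_xin s t).comp (hS.continuous_gradient_fState l)).sub
    (((hS.bddMeas_xtilde s).comp (hS.continuous_gradient_fState l)).add
      (hS.bddMeas_anchorNoise s l))

/-! The four dither error vectors of node `l`. -/

lemma isDitherVec_a (s : ℕ) (l : Fin N) :
    IsDitherVec S (n := fun j : {j // j ∈ nbr S.graph l} => S.m j.1)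
      (fun j k => .a s j.1 k) (S.step S.Ca s)
      (fun θ => select S.graph l (S.xhat θ.1 s (S.outer θ.1 θ.2 s) - (S.outer θ.1 θ.2 s).x)) :=
  fun j k => ⟨rfl, hS.step_pos _, fun θ => (S.outer θ.1 θ.2 s).xhat j.1 k,
    fun θ => (S.outer θ.1 θ.2 s).x j.1 k, (bddMeas_apply (hS.bddOuter s).xhat j.1 k).1,
    (bddMeas_apply (hS.bddOuter s).x j.1 k).1,
    (ignoresDither_outer (S := S) (s := s) le_rfl).comp fun o => o.xhat j.1 k,
    (ignoresDither_outer (S := S) (s := s) le_rfl).comp fun o => o.x j.1 k, fun _ => rfl⟩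

lemma isDitherVec_b (s : ℕ) (l : Fin N) :
    IsDitherVec S (n := fun j : {j // j ∈ nbr S.graph l} => S.m j.1)
      (fun j k => .b s l j.1 k) (S.step S.Cb s)
      (fun θ => S.ghat θ.1 s (S.outer θ.1 θ.2 s) l - S.grad θ.1 s (S.outer θ.1 θ.2 s) l) :=
  fun j k => ⟨rfl, hS.step_pos _, fun θ => (S.outer θ.1 θ.2 s).ghat l j k,
    fun θ => S.grad θ.1 s (S.outer θ.1 θ.2 s) l j k,
    (bddMeas_apply ((hS.bddOuter s).ghat l) j k).1,
    (bddMeas_apply (hS.bddMeas_grad (hS.bddOuter s) s l) j k).1,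
    (ignoresDither_outer (S := S) (s := s) le_rfl).comp fun o => o.ghat l j k,
    (ignoresDither_grad (S := S) (s := s) le_rfl (by simp)).comp fun g => g l j k, fun _ => rfl⟩

lemma isDitherVec_c (s t : ℕ) (l : Fin N) :
    IsDitherVec S (n := fun j : {j // j ∈ nbr S.graph l} => S.m j.1)
      (fun j k => .c s t j.1 k) (S.step S.Cc s)
      (fun θ => select S.graph l (S.xhatIn θ.1 s t (S.outer θ.1 θ.2 s) (S.xin θ.1 θ.2 s t)
        - S.xin θ.1 θ.2 s t)) :=
  fun j k => ⟨rfl, hS.step_pos _, fun θ => S.xhat θ.1 s (S.outer θ.1 θ.2 s) j.1 k,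
    fun θ => S.xin θ.1 θ.2 s t j.1 k,
    (bddMeas_apply (hS.bddMeas_xhat (hS.bddOuter s) s) j.1 k).1,
    (bddMeas_apply (hS.bddMeas_xin s t) j.1 k).1,
    (ignoresDither_xhat (S := S) (s := s) le_rfl (by simp)).comp fun x => x j.1 k,
    (ignoresDither_xin (S := S) (s := s) le_rfl fun _ => Nat.lt_succ_self t).comp
      fun x => x j.1 k, fun _ => rfl⟩

lemma isDitherVec_d (s t : ℕ) (l : Fin N) :
    IsDitherVec S (n := fun j : {j // j ∈ nbr S.graph l} => S.m j.1)
      (fun j k => .d s t l j.1 k) (S.step S.Cd s)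
      (fun θ => S.ghatIn θ.1 s t (S.outer θ.1 θ.2 s) (S.xin θ.1 θ.2 s t) l
        - S.gradIn θ.1 s t (S.outer θ.1 θ.2 s) (S.xin θ.1 θ.2 s t) l) :=
  fun j k => ⟨rfl, hS.step_pos _, fun θ => S.ghat θ.1 s (S.outer θ.1 θ.2 s) l j k,
    fun θ => S.gradIn θ.1 s t (S.outer θ.1 θ.2 s) (S.xin θ.1 θ.2 s t) l j k,
    (bddMeas_apply (hS.bddMeas_ghat (hS.bddOuter s) s l) j k).1,
    (bddMeas_apply (hS.bddMeas_gradIn (hS.bddOuter s) (hS.bddMeas_xin s t) s t l) j k).1,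
    (ignoresDither_ghat (S := S) (s := s) (q := .d s t l j.1 k) le_rfl (Nat.succ_pos t)).comp fun g => g l j k,
    (ignoresDither_xhatIn l j.1 k).comp
      fun x => (gradient (S.f l) (select S.graph l x)) j k, fun _ => rfl⟩

variable {H : ∀ l, LocalState S.m S.graph l →L[ℝ] LocalState S.m S.graph l}
  (hH : S.IsHessian H)

include hH

lemma anchorNoise_eq (s : ℕ) (l : Fin N) (θ : Inputs S.m) :
    S.anchorNoise s l θ = embed S.graph l
      (H l (select S.graph l (S.xhat θ.1 s (S.outer θ.1 θ.2 s) - (S.outer θ.1 θ.2 s).x))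
        + (S.ghat θ.1 s (S.outer θ.1 θ.2 s) l - S.grad θ.1 s (S.outer θ.1 θ.2 s) l)) := by
  rw [select_sub, ← hH.gradient_sub, anchorNoise, hS.gradient_fState, ← map_sub]
  congr 1
  simp only [grad, xtilde]
  abel

lemma innerNoise_eq (s t : ℕ) (l : Fin N) (θ : Inputs S.m) :
    S.innerNoise s t l θ = embed S.graph l
      (H l (select S.graph l (S.xhatIn θ.1 s t (S.outer θ.1 θ.2 s) (S.xin θ.1 θ.2 s t)
          - S.xin θ.1 θ.2 s t))
        + (S.ghatIn θ.1 s t (S.outer θ.1 θ.2 s) (S.xin θ.1 θ.2 s t) l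
          - S.gradIn θ.1 s t (S.outer θ.1 θ.2 s) (S.xin θ.1 θ.2 s t) l)) := by
  rw [select_sub, ← hH.gradient_sub, innerNoise, hS.gradient_fState, ← map_sub]
  congr 1
  simp only [gradIn]
  abel

variable {Q : Measure (Inputs S.m)} (hQ : IsInputLaw S Q)

include hQ

lemma integral_inner_anchorNoise {s : ℕ} (l : Fin N) {W : Inputs S.m → State S.m}
    (hW : BddMeas W)
    (hWq : ∀ q : DitherIndex S.m, q.outerTime = s → q.innerTime = 0 → IgnoresDither q W) :
    ∫ θ, Inner.inner ℝ (W θ) (S.anchorNoise s l θ) ∂Q = 0 := by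
  simp only [hS.anchorNoise_eq hH]
  exact integral_inner_noise hQ (hS.isDitherVec_a s l) (hS.isDitherVec_b s l) (H l)
    (embed S.graph l) hW (fun _ _ => hWq _ rfl rfl) (fun _ _ => hWq _ rfl rfl)

lemma integral_inner_innerNoise {s t : ℕ} (l : Fin N) {W : Inputs S.m → State S.m}
    (hW : BddMeas W)
    (hWq : ∀ q : DitherIndex S.m, q.outerTime = s → q.innerTime = t + 1 → IgnoresDither q W) :
    ∫ θ, Inner.inner ℝ (W θ) (S.innerNoise s t l θ) ∂Q = 0 := by
  simp only [hS.innerNoise_eq hH]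
  exact integral_inner_noise hQ (hS.isDitherVec_c s t l) (hS.isDitherVec_d s t l) (H l)
    (embed S.graph l) hW (fun _ _ => hWq _ rfl rfl) (fun _ _ => hWq _ rfl rfl)

lemma integral_norm_sq_anchorNoise_le (s : ℕ) (l : Fin N) :
    ∫ θ, ‖S.anchorNoise s l θ‖ ^ 2 ∂Q
      ≤ S.D * S.mbar / 12 * ((L : ℝ) ^ 2 * S.step S.Ca s ^ 2 + S.step S.Cb s ^ 2) := by
  have := hQ.isProbabilityMeasure
  have ha := hS.isDitherVec_a s l
  have hb := hS.isDitherVec_b s l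
  refine le_trans ?_ (integral_norm_sq_noise_le hQ ha hb (fun j k => ?_) (H l)
    (hH.norm_le hS l) (sum_local_dim_le S l))
  · refine integral_mono ((hS.bddMeas_anchorNoise s l).norm_sq.integrable Q)
      (((ha.bddMeas.comp (H l).continuous).add hb.bddMeas).norm_sq.integrable Q) fun θ => ?_
    simp only [hS.anchorNoise_eq hH]
    gcongr
    exact norm_embed_le _ _
  · exact (ignoresDither_xhat (S := S) (s := s) le_rfl (by simp)).comp₂
      (ignoresDither_outer (S := S) (s := s) le_rfl) fun x o => select S.graph l (x - o.x)

lemma integral_norm_sq_innerNoise_le (s t : ℕ) (l : Fin N) :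
    ∫ θ, ‖S.innerNoise s t l θ‖ ^ 2 ∂Q
      ≤ S.D * S.mbar / 12 * ((L : ℝ) ^ 2 * S.step S.Cc s ^ 2 + S.step S.Cd s ^ 2) := by
  have := hQ.isProbabilityMeasure
  have hc := hS.isDitherVec_c s t l
  have hd := hS.isDitherVec_d s t l
  refine le_trans ?_ (integral_norm_sq_noise_le hQ hc hd (fun j k => ?_) (H l)
    (hH.norm_le hS l) (sum_local_dim_le S l))
  · refine integral_mono ((hS.bddMeas_innerNoise s t l).norm_sq.integrable Q)
      (((hc.bddMeas.comp (H l).continuous).add hd.bddMeas).norm_sq.integrable Q) fun θ => ?_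
    simp only [hS.innerNoise_eq hH]
    gcongr
    exact norm_embed_le _ _
  · exact (ignoresDither_xhatIn l j.1 k).comp₂
      (ignoresDither_xin (S := S) (s := s) le_rfl fun _ => Nat.lt_succ_self t)
      fun x y => select S.graph l (x - y)

/-- The noise budget of one inner iteration: the noise of the current gradient counts once, the
noise of the gradients at `x̃^(s)` twice. -/
lemma noise_budget (hκ : 0 < S.κ) (s t : ℕ) :
    1 / N * ∑ l, (∫ θ, ‖S.innerNoise s t l θ‖ ^ 2 ∂Q + 2 * ∫ θ, ‖S.anchorNoise s l θ‖ ^ 2 ∂Q)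
      ≤ S.Cerr L * S.κ ^ (s + 1) / S.T := by
  have hN := hS.card_pos
  have hT : (0 : ℝ) < S.T := by exact_mod_cast hS.T_pos
  set K : ℝ := S.D * S.mbar / 12 with hK
  have hK0 : 0 ≤ K := by positivity
  set a := S.step S.Ca s ^ 2
  set b := S.step S.Cb s ^ 2
  set c := S.step S.Cc s ^ 2
  set d := S.step S.Cd s ^ 2
  have h1 : ∀ l, ∫ θ, ‖S.innerNoise s t l θ‖ ^ 2 ∂Q + 2 * ∫ θ, ‖S.anchorNoise s l θ‖ ^ 2 ∂Q
      ≤ K * (2 * (L : ℝ) ^ 2 * (a + c) + 2 * ((N + 1) / N) * b + d) := fun l => by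
    have h2 : _ ≤ K * ((L : ℝ) ^ 2 * c + d) := hS.integral_norm_sq_innerNoise_le hH hQ s t l
    have h3 : _ ≤ K * ((L : ℝ) ^ 2 * a + b) := hS.integral_norm_sq_anchorNoise_le hH hQ s l
    have h4 : (1 : ℝ) * b ≤ (N + 1) / N * b := by
      have hb : 0 ≤ b := by positivity
      have : (1 : ℝ) ≤ (N + 1) / N := by rw [le_div_iff₀ hN]; linarith
      gcongr
    have h5 : 0 ≤ K * ((L : ℝ) ^ 2 * c) := by positivity
    have h6 : K * (1 * b) ≤ K * ((N + 1) / N * b) := by gcongr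
    linarith
  calc _ ≤ 1 / (N : ℝ)
        * ∑ _l : Fin N, K * (2 * (L : ℝ) ^ 2 * (a + c) + 2 * ((N + 1) / N) * b + d) := by
        gcongr with l
        exact h1 l
    _ = K * (2 * (L : ℝ) ^ 2 * (a + c) + 2 * ((N + 1) / N) * b + d) := by
        rw [Finset.sum_const, Finset.card_univ, Fintype.card_fin, nsmul_eq_mul]
        field_simp
    _ = S.Cerr L * S.κ ^ (s + 1) / S.T := by
        simp only [a, b, c, d, step_sq hκ, Cerr, hK]
        field_simp

/-- The mean square error of the direction. -/
lemma integral_norm_sq_err_le (hκ : 0 < S.κ) (s t : ℕ) :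
    ∫ θ, ‖S.err θ.1 θ.2 s t‖ ^ 2 ∂Q ≤ S.Cerr L * S.κ ^ (s + 1) / S.T := by
  have hN := hS.card_pos
  simp only [hS.err_eq]
  refine (integral_norm_sq_estimator_le (A := S.innerNoise s t)
    (u := fun l θ => -S.anchorNoise s l θ) hQ hN (hS.bddMeas_innerNoise s t)
    (fun l => (hS.bddMeas_anchorNoise s l).comp continuous_neg) (ignoresNode_innerNoise s t)
    (fun l => (ignoresNode_anchorNoise s t l).comp fun x => -x) fun l => ?_).trans ?_
  · refine hS.integral_inner_innerNoise hH hQ l ?_ fun q h1 h2 => ?_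
    · exact ((hS.bddMeas_anchorNoise s l).comp continuous_neg).sub ((BddMeas.sum _ fun j _ =>
        (hS.bddMeas_anchorNoise s j).comp continuous_neg).comp (continuous_const_smul _))
    · intro ν ν' ell h
      simp only [fun j => ignoresDither_anchorNoise h1.ge (by omega) j ν ν' ell h]
  · refine le_trans ?_ (hS.noise_budget hH hQ hκ s t)
    simp only [norm_neg]
    gcongr with l
    have : 0 ≤ ∫ θ, ‖S.anchorNoise s l θ‖ ^ 2 ∂Q := integral_nonneg fun θ => by positivity
    linarith

/-- The direction is unbiased relative to everything known before inner iteration `t`. -/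
lemma integral_inner_dir_sub_gradient (s t : ℕ) {W : State S.m → State S.m} (hW : Continuous W) :
    ∫ θ, Inner.inner ℝ (W (S.xin θ.1 θ.2 s t))
      (S.dir θ.1 θ.2 s t (S.outer θ.1 θ.2 s) (S.xin θ.1 θ.2 s t)
        - gradient S.F (S.xin θ.1 θ.2 s t)) ∂Q = 0 := by
  simp only [hS.dir_sub_gradient_eq]
  have hWb := (hS.bddMeas_xin s t).comp hW
  refine integral_inner_estimator hQ hS.card_pos (hS.bddMeas_innerNoise s t)
    (hS.bddMeas_controlled s t) (ignoresNode_innerNoise s t) (ignoresNode_controlled s t)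
    hWb (ignoresNode_xin.comp W) fun l => ?_
  exact hS.integral_inner_innerNoise hH hQ l hWb fun q h1 h2 =>
    (ignoresDither_xin h1.ge fun _ => by omega).comp W

/-- The variance of the direction. The noise of the gradients at `x̃^(s)` is correlated with the
inner iterates, but not with `x̃^(s)` itself; so it is grouped with the gradient at `x̃^(s)`. -/
lemma integral_norm_sq_dir_sub_gradient_le (hκ : 0 < S.κ) {xstar : State S.m}
    (hxstar : ∀ z, S.G xstar ≤ S.G z) (h0 : (0 : State S.m) ∈ effDom S.R) (s t : ℕ)
    (hg : BddMeas fun θ : Inputs S.m => S.gap xstar (S.xin θ.1 θ.2 s t))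
    (hg' : BddMeas fun θ : Inputs S.m => S.gap xstar (S.xtilde θ.1 θ.2 s)) :
    ∫ θ, ‖S.dir θ.1 θ.2 s t (S.outer θ.1 θ.2 s) (S.xin θ.1 θ.2 s t)
        - gradient S.F (S.xin θ.1 θ.2 s t)‖ ^ 2 ∂Q
      ≤ S.Cerr L * S.κ ^ (s + 1) / S.T
        + 4 * L * (∫ θ, S.gap xstar (S.xin θ.1 θ.2 s t) ∂Q
          + ∫ θ, S.gap xstar (S.xtilde θ.1 θ.2 s) ∂Q) := by
  have := hQ.isProbabilityMeasure
  have hN := hS.card_pos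
  simp only [hS.dir_sub_gradient_eq]
  refine (integral_norm_sq_estimator_le hQ hN (hS.bddMeas_innerNoise s t)
    (hS.bddMeas_controlled s t) (ignoresNode_innerNoise s t) (ignoresNode_controlled s t)
    fun l => ?_).trans ?_
  · refine hS.integral_inner_innerNoise hH hQ l ?_ fun q h1 h2 => ?_
    · exact (hS.bddMeas_controlled s t l).sub ((BddMeas.sum _ fun j _ =>
        hS.bddMeas_controlled s t j).comp (continuous_const_smul _))
    · intro ν ν' ell h
      simp only [fun j => ignoresDither_controlled (t := t) h1.ge (by omega) j ν ν' ell h]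
  let p : Fin N → Inputs S.m → State S.m := fun l θ =>
    gradient (S.fState l) (S.xin θ.1 θ.2 s t) - gradient (S.fState l) xstar
  let r : Fin N → Inputs S.m → State S.m := fun l θ =>
    gradient (S.fState l) (S.xtilde θ.1 θ.2 s) - gradient (S.fState l) xstar
  have hp : ∀ l, BddMeas (p l) := fun l =>
    ((hS.bddMeas_xin s t).comp (hS.continuous_gradient_fState l)).sub (BddMeas.const _)
  have hr : ∀ l, BddMeas (r l) := fun l =>
    ((hS.bddMeas_xtilde s).comp (hS.continuous_gradient_fState l)).sub (BddMeas.const _)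
  have hY := hS.bddMeas_anchorNoise s
  have hpi : ∀ l, Integrable (fun θ => ‖p l θ‖ ^ 2) Q := fun l => (hp l).norm_sq.integrable Q
  have hcon : ∀ l, ∫ θ, ‖S.controlled s t l θ‖ ^ 2 ∂Q
      ≤ 2 * ∫ θ, ‖p l θ‖ ^ 2 ∂Q + 2 * ∫ θ, ‖r l θ‖ ^ 2 ∂Q
        + 2 * ∫ θ, ‖S.anchorNoise s l θ‖ ^ 2 ∂Q := fun l => by
    have hrY : ∫ θ, ‖r l θ + S.anchorNoise s l θ‖ ^ 2 ∂Q
        = ∫ θ, ‖r l θ‖ ^ 2 ∂Q + ∫ θ, ‖S.anchorNoise s l θ‖ ^ 2 ∂Q := by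
      rw [integral_norm_add_sq Q (hr l) (hY l), hS.integral_inner_anchorNoise hH hQ l (hr l)]
      · ring
      · intro q h1 h2
        exact (ignoresDither_outer (S := S) h1.ge).comp fun o =>
          gradient (S.fState l) o.x - gradient (S.fState l) xstar
    have hi := (((hr l).add (hY l)).norm_sq.integrable Q)
    have h1 : ∫ θ, ‖S.controlled s t l θ‖ ^ 2 ∂Q
        ≤ ∫ θ, (2 * ‖p l θ‖ ^ 2 + 2 * ‖r l θ + S.anchorNoise s l θ‖ ^ 2) ∂Q := by
      refine integral_mono ((hS.bddMeas_controlled s t l).norm_sq.integrable Q)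
        (((hpi l).const_mul 2).add (hi.const_mul 2)) fun θ => ?_
      have e : S.controlled s t l θ = p l θ - (r l θ + S.anchorNoise s l θ) := by
        simp only [controlled, p, r]
        abel
      rw [e]
      have := parallelogram_law_with_norm ℝ (p l θ) (r l θ + S.anchorNoise s l θ)
      have h0 := mul_self_nonneg ‖p l θ + (r l θ + S.anchorNoise s l θ)‖
      simp only [sq]
      linarith
    rw [integral_add ((hpi l).const_mul 2) (hi.const_mul 2), integral_const_mul,
      integral_const_mul, hrY] at h1
    linarith
  have hsm : ∀ {y : Inputs S.m → State S.m}, (∀ θ, y θ ∈ effDom S.R) → BddMeas y →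
      (BddMeas fun θ => S.gap xstar (y θ)) →
      1 / N * ∑ l, ∫ θ, ‖gradient (S.fState l) (y θ) - gradient (S.fState l) xstar‖ ^ 2 ∂Q
        ≤ 2 * L * ∫ θ, S.gap xstar (y θ) ∂Q := by
    intro y hy hyb hyg
    have hi : ∀ l, Integrable
        (fun θ => ‖gradient (S.fState l) (y θ) - gradient (S.fState l) xstar‖ ^ 2) Q := fun l =>
      ((hyb.comp (hS.continuous_gradient_fState l)).sub (BddMeas.const _)).norm_sq.integrable Q
    rw [← integral_finsetSum _ fun l _ => hi l, ← integral_const_mul, ← integral_const_mul]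
    exact integral_mono ((integrable_finsetSum _ fun l _ => hi l).const_mul _)
      ((hyg.integrable Q).const_mul _) fun θ => hS.sum_norm_gradient_sub_sq_le hxstar (hy θ)
  have h1 : 1 / N * ∑ l, ∫ θ, ‖p l θ‖ ^ 2 ∂Q ≤ _ := hsm (fun θ => hS.xin_mem (hS.xtilde_mem h0 θ.1 θ.2 s) t) (hS.bddMeas_xin s t) hg
  have h2 : 1 / N * ∑ l, ∫ θ, ‖r l θ‖ ^ 2 ∂Q ≤ _ := hsm (fun θ => hS.xtilde_mem h0 θ.1 θ.2 s) (hS.bddMeas_xtilde s) hg'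
  have h3 := hS.noise_budget hH hQ hκ s t
  have h4 : 1 / (N : ℝ) * ∑ l, (∫ θ, ‖S.innerNoise s t l θ‖ ^ 2 ∂Q
        + ∫ θ, ‖S.controlled s t l θ‖ ^ 2 ∂Q)
      ≤ 1 / N * ∑ l, ((∫ θ, ‖S.innerNoise s t l θ‖ ^ 2 ∂Q
          + 2 * ∫ θ, ‖S.anchorNoise s l θ‖ ^ 2 ∂Q)
        + 2 * ∫ θ, ‖p l θ‖ ^ 2 ∂Q + 2 * ∫ θ, ‖r l θ‖ ^ 2 ∂Q) :=
    mul_le_mul_of_nonneg_left (Finset.sum_le_sum fun l _ => by linarith [hcon l]) (by positivity)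
  simp only [mul_add, Finset.sum_add_distrib, ← Finset.mul_sum] at h3 h4 ⊢
  linarith

end Admissible

end Noise

end Setup

namespace Setup

variable {N : ℕ} {S : Setup N} {L : ℝ≥0}

/-! ### Convergence -/

namespace Admissible

variable (hS : S.Admissible L) {xstar : State S.m}

include hS

lemma bddMeas_err (s t : ℕ) : BddMeas fun θ : Inputs S.m => S.err θ.1 θ.2 s t := by
  have hell : Measurable fun θ : Inputs S.m => θ.2 s t :=
    measurable_pi_iff.1 (measurable_pi_iff.1 measurable_snd s) t
  have hY : ∀ l, BddMeas fun θ => -S.anchorNoise s l θ := fun l =>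
    (hS.bddMeas_anchorNoise s l).comp continuous_neg
  simp only [hS.err_eq]
  exact (BddMeas.select (hS.bddMeas_innerNoise s t) hell).add ((BddMeas.select hY hell).sub
    ((BddMeas.sum _ fun l _ => hY l).comp (continuous_const_smul _)))

/-- One inner iteration along a realization. The scalar product involves only the exact proximal
gradient step from the current iterate, which does not depend on the current direction. -/
lemma norm_xin_succ_sq_le (hηL : 4 * L * S.η < 1) (hmem : xstar ∈ effDom S.R) (θ : Inputs S.m)
    (s t : ℕ) :
    ‖S.xin θ.1 θ.2 s (t + 1) - xstar‖ ^ 2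
        + 2 * S.η * S.gap xstar (S.xin θ.1 θ.2 s (t + 1))
      ≤ ‖S.xin θ.1 θ.2 s t - xstar‖ ^ 2
        + 2 * S.η ^ 2 * ‖S.dir θ.1 θ.2 s t (S.outer θ.1 θ.2 s) (S.xin θ.1 θ.2 s t)
            - gradient S.F (S.xin θ.1 θ.2 s t)‖ ^ 2
        - 2 * S.η * Inner.inner ℝ
          (prox S.η S.R (S.xin θ.1 θ.2 s t - S.η • gradient S.F (S.xin θ.1 θ.2 s t)) - xstar)
          (S.dir θ.1 θ.2 s t (S.outer θ.1 θ.2 s) (S.xin θ.1 θ.2 s t)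
            - gradient S.F (S.xin θ.1 θ.2 s t)) := by
  have hη := hS.η_pos
  have hηL' : S.η * L ≤ 1 := by
    have : 0 ≤ L * S.η := by positivity
    linarith
  have hsucc : S.xin θ.1 θ.2 s (t + 1) = prox S.η S.R (S.xin θ.1 θ.2 s t
      - S.η • S.dir θ.1 θ.2 s t (S.outer θ.1 θ.2 s) (S.xin θ.1 θ.2 s t)) :=
    hS.inner_succ _ _ _ _ _
  set x := S.xin θ.1 θ.2 s t
  set v := S.dir θ.1 θ.2 s t (S.outer θ.1 θ.2 s) x
  have h1 := hS.reg.prox_step hη hS.differentiable_F hS.convexOn_F hS.lipschitz_F hηL' x v hmem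
  have h2 := hS.reg.prox_lipschitz hη (x - S.η • v) (x - S.η • gradient S.F x)
  rw [← hsucc] at h1 h2
  set y := S.xin θ.1 θ.2 s (t + 1)
  set z := prox S.η S.R (x - S.η • gradient S.F x)
  set e := v - gradient S.F x with he
  have h3 : ‖y - z‖ ≤ S.η * ‖e‖ := by
    have : x - S.η • v - (x - S.η • gradient S.F x) = -(S.η • e) := by rw [he, smul_sub]; abel
    rwa [this, norm_neg, norm_smul, Real.norm_of_nonneg hη.le] at h2
  have h4 : -(S.η * ‖e‖ ^ 2) ≤ Inner.inner ℝ e (y - z) := by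
    have := neg_le_of_abs_le (abs_real_inner_le_norm e (y - z))
    nlinarith [norm_nonneg e]
  have h5 : Inner.inner ℝ e (y - xstar) = Inner.inner ℝ e (y - z) + Inner.inner ℝ (z - xstar) e := by
    rw [real_inner_comm e (z - xstar), ← inner_add_right, sub_add_sub_cancel]
  rw [h5] at h1
  unfold gap
  nlinarith

section Bounded

variable (hηL : 4 * L * S.η < 1) (hxstar : ∀ z, S.G xstar ≤ S.G z)
  (h0 : (0 : State S.m) ∈ effDom S.R)

lemma bddMeas_dir_sub_gradient (s t : ℕ) : BddMeas fun θ : Inputs S.m =>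
    S.dir θ.1 θ.2 s t (S.outer θ.1 θ.2 s) (S.xin θ.1 θ.2 s t)
      - gradient S.F (S.xin θ.1 θ.2 s t) :=
  (hS.bddMeas_dir (hS.bddOuter s) (hS.bddMeas_xin s t) s t).sub
    ((hS.bddMeas_xin s t).comp hS.lipschitz_F.continuous)

lemma continuous_exact_step (xstar : State S.m) :
    Continuous fun x => prox S.η S.R (x - S.η • gradient S.F x) - xstar := by
  have := hS.lipschitz_F.continuous
  exact ((hS.reg.continuous_prox hS.η_pos).comp (by fun_prop)).sub continuous_const

include hηL hxstar h0

lemma bddMeas_gap_xin_succ (s t : ℕ) :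
    BddMeas fun θ : Inputs S.m => S.gap xstar (S.xin θ.1 θ.2 s (t + 1)) := by
  have hη := hS.η_pos
  refine ⟨(hS.measurable_gap xstar).comp (hS.bddMeas_xin s (t + 1)).1, ?_⟩
  have hb := (((hS.bddMeas_xin s t).sub (BddMeas.const xstar)).norm_sq.add
    ((hS.bddMeas_dir_sub_gradient s t).norm_sq.const_mul (2 * S.η ^ 2))).sub
    ((((hS.bddMeas_xin s t).comp (hS.continuous_exact_step xstar)).inner
      (hS.bddMeas_dir_sub_gradient s t)).const_mul (2 * S.η))
  obtain ⟨C, hC⟩ := hb.2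
  refine ⟨C / (2 * S.η), fun θ => ?_⟩
  have h1 := hS.norm_xin_succ_sq_le hηL (hS.xstar_mem hxstar) θ s t
  have h2 := (le_abs_self _).trans (hC θ)
  have h3 := hS.gap_nonneg hxstar (hS.xin_mem (hS.xtilde_mem h0 θ.1 θ.2 s) (t + 1))
  rw [Real.norm_of_nonneg h3, le_div_iff₀ (by positivity)]
  nlinarith [sq_nonneg ‖S.xin θ.1 θ.2 s (t + 1) - xstar‖]

omit hηL hxstar in
lemma gap_xtilde_succ_le (s : ℕ) (θ : Inputs S.m) :
    S.gap xstar (S.xtilde θ.1 θ.2 (s + 1))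
      ≤ 1 / S.T * ∑ t ∈ Finset.range S.T, S.gap xstar (S.xin θ.1 θ.2 s (t + 1)) :=
  hS.gap_average_le hS.T_pos fun t _ => hS.xin_mem (hS.xtilde_mem h0 θ.1 θ.2 s) (t + 1)

lemma bddMeas_gap_xtilde (s : ℕ) :
    BddMeas fun θ : Inputs S.m => S.gap xstar (S.xtilde θ.1 θ.2 s) := by
  cases s with
  | zero => exact BddMeas.const (S.gap xstar 0)
  | succ s =>
    refine ⟨(hS.measurable_gap xstar).comp (hS.bddMeas_xtilde (s + 1)).1, ?_⟩
    obtain ⟨C, hC⟩ := ((BddMeas.sum (Finset.range S.T) fun t _ =>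
      hS.bddMeas_gap_xin_succ hηL hxstar h0 s t).const_mul (1 / S.T)).2
    refine ⟨C, fun θ => ?_⟩
    rw [Real.norm_of_nonneg (hS.gap_nonneg hxstar (hS.xtilde_mem h0 θ.1 θ.2 (s + 1)))]
    exact (hS.gap_xtilde_succ_le h0 s θ).trans ((le_abs_self _).trans (hC θ))

lemma bddMeas_gap_xin (s t : ℕ) :
    BddMeas fun θ : Inputs S.m => S.gap xstar (S.xin θ.1 θ.2 s t) := by
  cases t with
  | zero => exact hS.bddMeas_gap_xtilde hηL hxstar h0 s
  | succ t => exact hS.bddMeas_gap_xin_succ hηL hxstar h0 s t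

variable {H : ∀ l, LocalState S.m S.graph l →L[ℝ] LocalState S.m S.graph l}
  (hH : S.IsHessian H) {Q : Measure (Inputs S.m)} (hQ : IsInputLaw S Q) (hκ : 0 < S.κ)

include hH hQ hκ

/-- One inner iteration in expectation. -/
lemma integral_norm_xin_succ_sq_le (s t : ℕ) :
    ∫ θ, ‖S.xin θ.1 θ.2 s (t + 1) - xstar‖ ^ 2 ∂Q
        + 2 * S.η * ∫ θ, S.gap xstar (S.xin θ.1 θ.2 s (t + 1)) ∂Q
      ≤ ∫ θ, ‖S.xin θ.1 θ.2 s t - xstar‖ ^ 2 ∂Q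
        + 2 * S.η ^ 2 * (S.Cerr L * S.κ ^ (s + 1) / S.T
          + 4 * L * (∫ θ, S.gap xstar (S.xin θ.1 θ.2 s t) ∂Q
            + ∫ θ, S.gap xstar (S.xtilde θ.1 θ.2 s) ∂Q)) := by
  have := hQ.isProbabilityMeasure
  have hd : ∀ t, Integrable (fun θ : Inputs S.m => ‖S.xin θ.1 θ.2 s t - xstar‖ ^ 2) Q := fun t =>
    ((hS.bddMeas_xin s t).sub (BddMeas.const xstar)).norm_sq.integrable Q
  have hg := (hS.bddMeas_gap_xin_succ hηL hxstar h0 s t).integrable Q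
  have he := (hS.bddMeas_dir_sub_gradient s t).norm_sq.integrable Q
  have hi := ((((hS.bddMeas_xin s t).comp (hS.continuous_exact_step xstar)).inner
      (hS.bddMeas_dir_sub_gradient s t)).integrable Q)
  have hunb := hS.integral_inner_dir_sub_gradient hH hQ s t (hS.continuous_exact_step xstar)
  have hvar := hS.integral_norm_sq_dir_sub_gradient_le hH hQ hκ hxstar h0 s t
    (hS.bddMeas_gap_xin hηL hxstar h0 s t) (hS.bddMeas_gap_xtilde hηL hxstar h0 s)
  have hde : Integrable (fun θ : Inputs S.m => ‖S.xin θ.1 θ.2 s t - xstar‖ ^ 2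
      + 2 * S.η ^ 2 * ‖S.dir θ.1 θ.2 s t (S.outer θ.1 θ.2 s) (S.xin θ.1 θ.2 s t)
        - gradient S.F (S.xin θ.1 θ.2 s t)‖ ^ 2) Q := (hd t).add (he.const_mul (2 * S.η ^ 2))
  have hmono := integral_mono ((hd (t + 1)).add (hg.const_mul (2 * S.η)))
    (hde.sub (hi.const_mul (2 * S.η)))
    fun θ => hS.norm_xin_succ_sq_le hηL (hS.xstar_mem hxstar) θ s t
  simp only [Pi.add_apply, Pi.sub_apply] at hmono
  rw [integral_add (hd (t + 1)) (hg.const_mul _), integral_const_mul,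
    integral_sub hde (hi.const_mul _), integral_const_mul, hunb, mul_zero, sub_zero,
    integral_add (hd t) (he.const_mul _), integral_const_mul] at hmono
  have hη2 : 0 ≤ 2 * S.η ^ 2 := by positivity
  linarith [mul_le_mul_of_nonneg_left hvar hη2]

/-- One outer iteration in expectation. The noise enters with `κ^(s+1)`, not only `κ^s`, and this is
what makes the recursion close with the constant `β C / (1 - α / κ)`. -/
lemma integral_gap_xtilde_succ_le {μ : ℝ} (hμ : 0 < μ) (hstrong : IsStronglyConvex μ S.G)
    (s : ℕ) :
    ∫ θ, S.gap xstar (S.xtilde θ.1 θ.2 (s + 1)) ∂Q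
      ≤ S.alpha μ L * ∫ θ, S.gap xstar (S.xtilde θ.1 θ.2 s) ∂Q
        + S.beta L * (S.Cerr L * S.κ ^ (s + 1)) := by
  have := hQ.isProbabilityMeasure
  have hη := hS.η_pos
  have hT : (0 : ℝ) < S.T := by exact_mod_cast hS.T_pos
  set g : ℕ → ℝ := fun t => ∫ θ, S.gap xstar (S.xin θ.1 θ.2 s t) ∂Q with hg
  set d : ℕ → ℝ := fun t => ∫ θ, ‖S.xin θ.1 θ.2 s t - xstar‖ ^ 2 ∂Q with hd
  set B := S.Cerr L * S.κ ^ (s + 1) with hB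
  have hg0 : ∫ θ, S.gap xstar (S.xtilde θ.1 θ.2 s) ∂Q = g 0 := rfl
  have hgnn : ∀ t, 0 ≤ g t := fun t => integral_nonneg fun θ =>
    hS.gap_nonneg hxstar (hS.xin_mem (hS.xtilde_mem h0 θ.1 θ.2 s) t)
  have hdnn : ∀ t, 0 ≤ d t := fun t => integral_nonneg fun θ => by positivity
  have hstep : ∀ t, d (t + 1) + 2 * S.η * g (t + 1)
      ≤ d t + 2 * S.η ^ 2 * (B / S.T + 4 * L * (g t + g 0)) := fun t =>
    hS.integral_norm_xin_succ_sq_le hηL hxstar h0 hH hQ hκ s t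
  have hsum : ∀ n : ℕ, d n + 2 * S.η * ∑ t ∈ Finset.range n, g (t + 1)
      ≤ d 0 + 2 * S.η ^ 2 * (n * (B / S.T) + 4 * L * (∑ t ∈ Finset.range n, g t + n * g 0)) := by
    intro n
    induction n with
    | zero => simp
    | succ n ih =>
      rw [Finset.sum_range_succ, Finset.sum_range_succ]
      push_cast
      linarith [hstep n]
  have hshift : ∑ t ∈ Finset.range S.T, g t ≤ ∑ t ∈ Finset.range S.T, g (t + 1) + g 0 := by
    rw [← Finset.sum_range_succ' g, Finset.sum_range_succ]
    linarith [hgnn S.T]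
  have hd0 : d 0 ≤ 2 / μ * g 0 := by
    have h1 : μ / 2 * d 0 ≤ g 0 := by
      rw [hd, hg]
      simp only
      rw [← integral_const_mul]
      exact integral_mono
        ((((hS.bddMeas_xin s 0).sub (BddMeas.const xstar)).norm_sq.integrable Q).const_mul _)
        ((hS.bddMeas_gap_xin hηL hxstar h0 s 0).integrable Q) fun θ =>
        hS.norm_sub_sq_le_gap hxstar hstrong (hS.xin_mem (hS.xtilde_mem h0 θ.1 θ.2 s) 0)
    calc d 0 = 2 / μ * (μ / 2 * d 0) := by field_simp
      _ ≤ 2 / μ * g 0 := by gcongr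
  have havg : ∫ θ, S.gap xstar (S.xtilde θ.1 θ.2 (s + 1)) ∂Q
      ≤ 1 / S.T * ∑ t ∈ Finset.range S.T, g (t + 1) := by
    have hint : ∀ t, Integrable (fun θ => S.gap xstar (S.xin θ.1 θ.2 s (t + 1))) Q := fun t =>
      (hS.bddMeas_gap_xin_succ hηL hxstar h0 s t).integrable Q
    rw [hg]
    simp only
    rw [← integral_finsetSum _ fun t _ => hint t, ← integral_const_mul]
    exact integral_mono ((hS.bddMeas_gap_xtilde hηL hxstar h0 (s + 1)).integrable Q)
      ((integrable_finsetSum _ fun t _ => hint t).const_mul _)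
      fun θ => hS.gap_xtilde_succ_le h0 s θ
  rw [hg0]
  refine havg.trans ?_
  set total := ∑ t ∈ Finset.range S.T, g (t + 1)
  have hc : 0 < 1 - 4 * L * S.η := by linarith
  have hTB : (S.T : ℝ) * (B / S.T) = B := by field_simp
  have hmain : 2 * S.η * (1 - 4 * L * S.η) * total
      ≤ (2 / μ + 8 * S.η ^ 2 * L * (S.T + 1)) * g 0 + 2 * S.η ^ 2 * B := by
    have h1 := hsum S.T
    rw [hTB] at h1
    have h2 : 2 * S.η ^ 2 * (4 * L) * ∑ t ∈ Finset.range S.T, g t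
        ≤ 2 * S.η ^ 2 * (4 * L) * (total + g 0) := by gcongr
    linarith [hdnn S.T]
  -- dividing by `2 η (1 - 4 L η) T` gives exactly `α` and `β`
  have e : S.alpha μ L * g 0 + S.beta L * B
      = 1 / (S.T * (2 * S.η * (1 - 4 * L * S.η)))
        * ((2 / μ + 8 * S.η ^ 2 * L * (S.T + 1)) * g 0 + 2 * S.η ^ 2 * B) := by
    unfold alpha beta
    field_simp
    ring
  rw [e]
  calc 1 / (S.T : ℝ) * total
      = 1 / (S.T * (2 * S.η * (1 - 4 * L * S.η))) * (2 * S.η * (1 - 4 * L * S.η) * total) := by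
        generalize 1 - 4 * (L : ℝ) * S.η = c at hc ⊢
        field_simp
    _ ≤ _ := by gcongr

/-- Linear convergence in expectation, for real-valued optimality gaps. -/
lemma integral_gap_xtilde_le {μ : ℝ} (hμ : 0 < μ) (hstrong : IsStronglyConvex μ S.G)
    (hα : S.alpha μ L < S.κ) (s : ℕ) :
    ∫ θ, S.gap xstar (S.xtilde θ.1 θ.2 s) ∂Q
      ≤ S.κ ^ s * (S.gap xstar 0
        + S.beta L * S.Cerr L * (1 / (1 - S.alpha μ L / S.κ))) := by
  have := hQ.isProbabilityMeasure
  have hη := hS.η_pos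
  have hT : (0 : ℝ) < S.T := by exact_mod_cast hS.T_pos
  have hc : 0 < 1 - 4 * L * S.η := by linarith
  have hα0 : 0 ≤ S.alpha μ L := by unfold alpha; positivity
  have hβ0 : 0 ≤ S.beta L := by unfold beta; positivity
  have hC0 : 0 ≤ S.Cerr L := by unfold Cerr; positivity
  have hq : 0 < 1 - S.alpha μ L / S.κ := sub_pos.2 ((div_lt_one hκ).2 hα)
  have hgap0 : 0 ≤ S.gap xstar 0 := hS.gap_nonneg hxstar h0
  set K := S.beta L * S.Cerr L * (1 / (1 - S.alpha μ L / S.κ)) with hK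
  -- `K` is the fixed point of the perturbed recursion in units of `κ^s`
  have hfix : S.alpha μ L * K + S.beta L * S.Cerr L * S.κ = S.κ * K := by
    rw [hK]
    have h1 : S.κ - S.alpha μ L ≠ 0 := by linarith
    field_simp
    ring
  induction s with
  | zero =>
    have h1 : ∫ θ : Inputs S.m, S.gap xstar (S.xtilde θ.1 θ.2 0) ∂Q = S.gap xstar 0 := by
      change ∫ _ : Inputs S.m, S.gap xstar 0 ∂Q = _
      simp
    have hK0 : 0 ≤ K := by positivity
    rw [h1]
    linarith
  | succ s ih =>
    refine (hS.integral_gap_xtilde_succ_le hηL hxstar h0 hH hQ hκ hμ hstrong s).trans ?_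
    have h1 := mul_le_mul_of_nonneg_left ih hα0
    have h2 : S.alpha μ L * (S.κ ^ s * S.gap xstar 0) ≤ S.κ * (S.κ ^ s * S.gap xstar 0) := by
      gcongr
    have h3 : S.κ ^ s * (S.alpha μ L * K + S.beta L * S.Cerr L * S.κ) = S.κ ^ s * (S.κ * K) := by
      rw [hfix]
    rw [pow_succ]
    linarith

end Bounded

end Admissible

end Setup

end QuantSVRG

theorem theorem3 {N : ℕ} (S : Setup N)
    -- the network is connected; the algorithm's parameters are meaningful
    (hconn : S.graph.Connected)
    (hT : 1 ≤ S.T) (hη : 0 < S.η) (hbits : 1 ≤ S.bits)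
    (hκ0 : 0 < S.κ) (hκ1 : S.κ < 1)
    (hCa : 0 < S.Ca) (hCb : 0 < S.Cb) (hCc : 0 < S.Cc) (hCd : 0 < S.Cd)
    -- local objectives: convex and differentiable, with Lipschitz and affine gradients
    (L : Fin N → ℝ≥0)
    (hconv : ∀ i, ConvexOn ℝ Set.univ (S.f i))
    (hdiff : ∀ i, Differentiable ℝ (S.f i))
    (hLip : ∀ i, LipschitzWith (L i) (gradient (S.f i)))
    (haff : ∀ i, ∃ (H : LocalState S.m S.graph i →ₗ[ℝ] LocalState S.m S.graph i)
      (h : LocalState S.m S.graph i), ∀ z, gradient (S.f i) z = H z + h)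
    -- the regularizer; its proximal operation is performed locally
    (hR : IsRegularizer S.R)
    (hprox : ∀ (v : State S.m) (i : Fin N), prox S.η S.R v i = prox S.η (S.Rloc i) (v i))
    -- strong convexity of the objective, and its minimizer
    (μ : ℝ) (hμ : 0 < μ) (hstrong : IsStronglyConvex μ S.G)
    (xstar : State S.m) (hxstar : ∀ z, S.G xstar ≤ S.G z)
    -- the randomness
    {Ω : Type*} [MeasurableSpace Ω] (P : Measure Ω) [IsProbabilityMeasure P]
    (ν : DitherIndex S.m → Ω → ℝ) (ell : ℕ → ℕ → Ω → Fin N)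
    (hrand : S.IsRandomInput P ν ell)
    -- the transmitted values lie in their quantization intervals
    (p : ℕ)
    (hrange : ∀ s, 1 ≤ s → s ≤ p - 1 →
      ∀ᵐ ω ∂P, S.InRange (fun q => ν q ω) (fun a b => ell a b ω) s)
    -- the largest Lipschitz constant
    (Lbar : ℝ) (hLbar : Lbar = ((Finset.univ.sup L : ℝ≥0) : ℝ)) :
    (∀ k < p, S.Gam P ν ell k ≤ ENNReal.ofReal (S.Cerr Lbar * S.κ ^ k)) ∧
    (4 * Lbar * S.η < 1 → S.alpha μ Lbar < S.κ →
      ∀ s ≤ p, (S.expGap P ν ell xstar s : EReal)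
        ≤ ((S.κ ^ s : ℝ) : EReal) * (S.G 0 - S.G xstar
            + ((S.beta Lbar * S.Cerr Lbar * (1 / (1 - S.alpha μ Lbar / S.κ)) : ℝ) : EReal))) := by
  subst hLbar
  set Lb : ℝ≥0 := Finset.univ.sup L
  have hstep : ∀ C, 0 < C → ∀ s, 0 < S.step C s := fun C hC s => by
    have h2 : (1 : ℝ) < 2 ^ S.bits := one_lt_pow₀ one_lt_two (by omega)
    have h3 : (0 : ℝ) < 2 ^ S.bits - 1 := by linarith
    unfold Setup.step Setup.U
    positivity
  have hS : S.Admissible Lb :=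
    { nonempty := hconn.nonempty
      T_pos := hT
      η_pos := hη
      step_pos := by
        rintro (_ | _ | _ | _)
        exacts [hstep _ hCa _, hstep _ hCb _, hstep _ hCc _, hstep _ hCd _]
      convex := hconv
      diff := hdiff
      lip := fun i => (hLip i).weaken (Finset.le_sup (Finset.mem_univ i))
      reg := hR
      prox_apply := hprox }
  -- only the differences of the gradients matter, so the affine parts are dropped
  choose H h hHh using haff
  have hH : S.IsHessian fun l => LinearMap.toContinuousLinearMap (H l) :=
    ⟨fun l z w => by simp [hHh]⟩
  have hΞ := measurable_inputs hrand
  have hQ := isInputLaw_map hrand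
  have hQprob := hQ.isProbabilityMeasure
  have hlint : ∀ {φ : Inputs S.m → ℝ}, BddMeas φ → (∀ θ, 0 ≤ φ θ) →
      ∫⁻ ω, ENNReal.ofReal (φ (inputs ν ell ω)) ∂P
        = ENNReal.ofReal (∫ θ, φ θ ∂(P.map (inputs ν ell))) := by
    intro φ hφ hφ0
    rw [ofReal_integral_eq_lintegral_ofReal (hφ.integrable _) (Filter.Eventually.of_forall hφ0),
      lintegral_map hφ.1.ennreal_ofReal hΞ]
  refine ⟨fun k _ => ?_, fun hηL hα s _ => ?_⟩
  · have hC0 : 0 ≤ S.Cerr Lb := by unfold Setup.Cerr; positivity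
    have hTpos : (0 : ℝ) < S.T := by exact_mod_cast hT
    have hterm : ∀ t, ∫⁻ ω, ENNReal.ofReal
        (‖S.err (fun q => ν q ω) (fun a b => ell a b ω) k t‖ ^ 2) ∂P
        ≤ ENNReal.ofReal (S.Cerr Lb * S.κ ^ (k + 1) / S.T) := fun t =>
      (hlint (hS.bddMeas_err k t).norm_sq fun θ => by positivity).trans_le
        (ENNReal.ofReal_le_ofReal (hS.integral_norm_sq_err_le hH hQ hκ0 k t))
    calc S.Gam P ν ell k
        ≤ ∑ _t ∈ Finset.range S.T, ENNReal.ofReal (S.Cerr Lb * S.κ ^ (k + 1) / S.T) :=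
          Finset.sum_le_sum fun t _ => hterm t
      _ = ENNReal.ofReal (S.Cerr Lb * S.κ ^ (k + 1)) := by
          rw [← ENNReal.ofReal_sum_of_nonneg fun _ _ => by positivity, Finset.sum_const,
            Finset.card_range, nsmul_eq_mul]
          congr 1
          field_simp
      _ ≤ _ := ENNReal.ofReal_le_ofReal (mul_le_mul_of_nonneg_left
          (pow_le_pow_of_le_one hκ0.le hκ1.le (Nat.le_succ k)) hC0)
  · have hmem := hS.xstar_mem hxstar
    by_cases h0 : (0 : State S.m) ∈ effDom S.R
    · have hGsub : ∀ x ∈ effDom S.R, S.G x - S.G xstar = ((S.gap xstar x : ℝ) : EReal) := by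
        intro x hx
        rw [hS.coe_G hx, hS.coe_G hmem, ← EReal.coe_sub]
        rfl
      have hexp : S.expGap P ν ell xstar s
          = ENNReal.ofReal (∫ θ, S.gap xstar (S.xtilde θ.1 θ.2 s) ∂(P.map (inputs ν ell))) := by
        rw [← hlint (hS.bddMeas_gap_xtilde hηL hxstar h0 s) fun θ =>
          hS.gap_nonneg hxstar (hS.xtilde_mem h0 θ.1 θ.2 s)]
        refine lintegral_congr fun ω => ?_
        rw [hGsub _ (hS.xtilde_mem h0 _ _ s), EReal.toENNReal_of_ne_top (EReal.coe_ne_top _),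
          EReal.toReal_coe]
        rfl
      rw [hexp, hGsub 0 h0, EReal.coe_ennreal_ofReal, max_eq_left (integral_nonneg fun θ =>
          hS.gap_nonneg hxstar (hS.xtilde_mem h0 θ.1 θ.2 s)), ← EReal.coe_add, ← EReal.coe_mul,
        EReal.coe_le_coe_iff]
      exact hS.integral_gap_xtilde_le hηL hxstar h0 hH hQ hκ0 hμ hstrong hα s
    · -- an infinite initial gap makes the bound infinite
      have hG0 : S.G 0 = ⊤ := by rw [Setup.G, hR.eq_top h0, EReal.coe_add_top]
      rw [hG0, hS.coe_G hmem, EReal.top_sub_coe, EReal.top_add_coe,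
        EReal.coe_mul_top_of_pos (by positivity)]
      exact le_top
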